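/- Let $1<\alpha\le 2$, let $[\alpha]$ denote the integer part of $\alpha$, and let $$\widetilde W_2(z)=\Bigl(\tfrac{3\alpha-2}{2\alpha}-\tfrac{2(\alpha-1)}{\alpha}z+\tfrac{\alpha-2}{2\alpha}z^2\Bigr)^{\alpha}=\sum_{\ell=0}^{\infty}\kappa_{2,\ell}^{(\alpha)}z^\ell,\qquad |z|<1 .$$ For $h>0$ and $u:\mathbb R\to\mathbb R$ put $${}^{L}\mathcal B_2^{\alpha}u(x)=\frac1{h^{\alpha}}\sum_{\ell=0}^{\infty}\kappa_{2,\ell}^{(\alpha)}\,u\bigl(x-(\ell-1)h\bigr),$$ and for $\beta>0$ and $m=[\beta]+1$ let $${}_{RL}D_{-\infty,x}^{\beta}u(x)=\frac1{\Gamma(m-\beta)}\frac{d^m}{dx^m}\int_{-\infty}^{x}\frac{u(s)\,ds}{(x-s)^{\beta-m+1}} .$$ There are real numbers $\gamma_\ell^\alpha$ ($\ell\ge1$), depending only on $\alpha$, such that for all sufficiently small $z>0$ $$\frac{e^{z}}{z^{\alpha}}\widetilde W_2(e^{-z})=1+\sum_{\ell=1}^{\infty}\gamma_\ell^{\alpha}z^{\ell};$$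 the first three are $$\gamma_1^\alpha=0,\qquad \gamma_2^\alpha=-\frac{2\alpha^2-6\alpha+3}{6\alpha},\qquad \gamma_3^\alpha=\frac{3\alpha^3-11\alpha^2+12\alpha-4}{12\alpha^2}.$$ Moreover, let $n\ge2$, let $u\in C^{[\alpha]+n+1}(\mathbb R)$, and let all derivatives of $u$ of orders $0,1,\dots,[\alpha]+n+2$ belong to $L_1(\mathbb R)$, the one of order $[\alpha]+n+2$ being understood as a weak derivative (so that $u^{([\alpha]+n+1)}$ is locally absolutely continuous). Then the series defining ${}^{L}\mathcal B_2^{\alpha}u(x)$ converges for all $h>0$ and $x\in\mathbb R$, the derivatives ${}_{RL}D_{-\infty,x}^{\alpha+\ell}u$ ($0\le\ell\le n-1$) exist on $\mathbb R$, and $${}^{L}\mathcal B_2^{\alpha}u(x)={}_{RL}D_{-\infty,x}^{\alpha}u(x)+\sum_{\ell=1}^{n-1}\gamma_\ell^{\alpha}\,{}_{RL}D_{-\infty,x}^{\alpha+\ell}u(x)\,h^{\ell}+\mathcal O(h^{n}),$$ uniformly in $x$: there is a constant $C$, independent of $h$ and $x$, such that the remainder is at most $Ch^n$ in absolute value for all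 $h>0$ and all $x\in\mathbb R$. -/

import Mathlib

open MeasureTheory

noncomputable section

/-- The generating function
`W(z) = ((3α-2)/(2α) - (2(α-1)/α) z + ((α-2)/(2α)) z²) ^ α`. For `α > 1` its base is positive on
`(-1, 1)`, so there the power is the power of a positive real number. -/
def genW (α z : ℝ) : ℝ :=
  ((3 * α - 2) / (2 * α) - 2 * (α - 1) / α * z + (α - 2) / (2 * α) * z ^ 2) ^ α

/-- The coefficients `κ_ℓ` of the power series `W(z) = ∑ κ_ℓ z^ℓ` at `0`. -/
def kappa (α : ℝ) (l : ℕ) : ℝ :=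
  iteratedDeriv l (genW α) 0 / (l.factorial : ℝ)

/-- The `l`-th term `κ_l u(x - (l - 1) h)` of the difference operator. -/
def leftBTerm (α h : ℝ) (u : ℝ → ℝ) (x : ℝ) (l : ℕ) : ℝ :=
  kappa α l * u (x - ((l : ℝ) - 1) * h)

/-- The difference operator `h^{-α} ∑_{ℓ ≥ 0} κ_ℓ u(x - (ℓ - 1) h)`. -/
def leftB (α h : ℝ) (u : ℝ → ℝ) (x : ℝ) : ℝ :=
  1 / h ^ α * ∑' l : ℕ, leftBTerm α h u x l

/-- The integer `m = [β] + 1` with `m - 1 ≤ β < m`. -/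
def rlOrder (β : ℝ) : ℕ := ⌊β⌋₊ + 1

/-- The integrand `u(s) / (x - s)^{β - m + 1}`, `m = [β] + 1`, of the left Riemann-Liouville
(Liouville) derivative of order `β`. -/
def rlIntegrand (β : ℝ) (u : ℝ → ℝ) (x s : ℝ) : ℝ :=
  u s / (x - s) ^ (β - (rlOrder β : ℝ) + 1)

/-- `x ↦ ∫_{-∞}^x u(s) / (x - s)^{β - m + 1} ds`, `m = [β] + 1`. -/
def rlPrimitive (β : ℝ) (u : ℝ → ℝ) (x : ℝ) : ℝ :=
  ∫ s in Set.Iic x, rlIntegrand β u x s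

/-- The left Riemann-Liouville derivative with base point `-∞`,
`(1 / Γ(m - β)) (d/dx)^m ∫_{-∞}^x u(s) / (x - s)^{β - m + 1} ds`, `m = [β] + 1`. -/
def rlDeriv (β : ℝ) (u : ℝ → ℝ) (x : ℝ) : ℝ :=
  1 / Real.Gamma ((rlOrder β : ℝ) - β) * iteratedDeriv (rlOrder β) (rlPrimitive β u) x

/-- The left Riemann-Liouville derivative of order `β` of `u` exists on the whole line: the
integral converges absolutely at every point and is `m = [β] + 1` times continuously
differentiable. -/
def RLDifferentiable (β : ℝ) (u : ℝ → ℝ) : Prop :=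
  (∀ x : ℝ, IntegrableOn (rlIntegrand β u x) (Set.Iic x)) ∧
    ContDiff ℝ (rlOrder β : WithTop ℕ∞) (rlPrimitive β u)

/-- For `u` of class `C^M`: all derivatives of `u` of orders `0, …, M + 1` belong to `L¹(ℝ)`.
The derivative of order `M + 1` is the derivative of the continuous function `u^{(M)}` in the
sense of locally absolutely continuous functions (equivalently, the weak derivative). -/
def DerivsInL1 (M : ℕ) (u : ℝ → ℝ) : Prop :=
  (∀ k ≤ M, Integrable (iteratedDeriv k u)) ∧
    ∃ g : ℝ → ℝ, Integrable g ∧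
      ∀ a b : ℝ, iteratedDeriv M u b - iteratedDeriv M u a = ∫ x in a..b, g x

/-- `γ` is the sequence of power series coefficients at `0` of `e^z z^{-α} W(e^{-z})`; the
identity for small `z > 0` determines `γ`. -/
def IsSymbolExpansion (α : ℝ) (γ : ℕ → ℝ) : Prop :=
  ∃ r > 0, ∀ z : ℝ, 0 < z → z < r →
    HasSum (fun l : ℕ => γ l * z ^ l) (Real.exp z / z ^ α * genW α (Real.exp (-z)))

end

/-! ### Coefficients of the generating function: absolute summability and the closed unit disc. -/

noncomputable section

namespace FracDiff

open Filter Topology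
open scoped Nat

/-! The proof compares Fourier multipliers. With `freq ξ = 2πiξ`, the derivative of order β
multiplies the transform of u by `freq ξ ^ β` (`rlDeriv_eq_integral`), while the difference operator
multiplies it by h^{-α} e^z W(e^{-z}) at z = h · `freq ξ` (`tsum_leftBTerm_eq_integral`). Since e^z
W(e^{-z}) = z^α (1 + γ₁ z + γ₂ z² + ...) near 0, the claim reduces to bounding the multiplier error
by C h^n |`freq ξ`|^{α+n} at all frequencies, and to the integrability of |`freq ξ`|^{α+n} |û|.

The points e^{-z} lie on the unit circle, so the power series of W is needed on the closed disc. The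
base of W is a constant times (1 - z)(1 + qz) with 0 ≤ q < 1, and the coefficients of (1 - z)^α are
absolutely summable because they have constant sign from index 2 on (`summable_grunwaldCoeff`,
`hasSum_genWC`). Near z = 0 the error bound is a Taylor estimate; away from 0 it is trivial because
W is bounded on the disc (`exists_symbol_bound`).

For integrability, the M = [α]+n+1 classical derivatives and the additional weak one give |û| =
O(|ξ|^{-(M+1)}) at infinity, which suffices as α + n < M. The multiplier of the Riemann-Liouville
derivative comes from the Gamma integral at complex rate, damped by e^{-εt} and passed to the limit
(`liouville_eq_fourier`). -/

theorem succ_mul_choose_succ (a : ℝ) (n : ℕ) :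
    ((n : ℝ) + 1) * Ring.choose a (n + 1) = Ring.choose a n * (a - n) := by
  rw [Ring.choose_eq_smul, Ring.choose_eq_smul, Nat.factorial_succ]
  simp only [descPochhammer_succ_right, Polynomial.smeval_mul, Polynomial.smeval_sub,
    Polynomial.smeval_X, Polynomial.smeval_natCast, smul_eq_mul, pow_one, pow_zero, nsmul_eq_mul,
    mul_one]
  push_cast
  have h1 : ((n : ℝ) + 1) ≠ 0 := by positivity
  have h2 : (n ! : ℝ) ≠ 0 := by positivity
  field_simp

theorem hasSum_one_add_cpow (a : ℝ) {w : ℂ} (hw : ‖w‖ < 1) :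
    HasSum (fun n : ℕ => ((Ring.choose a n : ℝ) : ℂ) * w ^ n) ((1 + w) ^ (a : ℂ)) := by
  have h := (Complex.one_add_cpow_hasFPowerSeriesOnBall_zero (a := (a : ℂ))).hasSum
    (y := w) (by simpa [enorm_eq_nnnorm, ← NNReal.coe_lt_coe] using hw)
  simpa [binomialSeries, FormalMultilinearSeries.coeff_ofScalars, mul_comm, Complex.ofReal_choose] using h

/-- The coefficients of `(1 - z) ^ a`. -/
def grunwaldCoeff (a : ℝ) (n : ℕ) : ℝ := (-1) ^ n * Ring.choose a n

theorem succ_mul_grunwaldCoeff_succ (a : ℝ) (n : ℕ) :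
    ((n : ℝ) + 1) * grunwaldCoeff a (n + 1) = grunwaldCoeff a n * (n - a) := by
  have := succ_mul_choose_succ a n
  simp only [grunwaldCoeff, pow_succ]
  linear_combination (-(-1) ^ n) * this

theorem grunwaldCoeff_zero (a : ℝ) : grunwaldCoeff a 0 = 1 := by simp [grunwaldCoeff]

theorem grunwaldCoeff_one (a : ℝ) : grunwaldCoeff a 1 = -a := by simp [grunwaldCoeff]

/-- The recurrence multiplies by n - a, which is nonnegative from n = 2 on; the starting value is
a(a - 1)/2. -/
theorem grunwaldCoeff_nonneg {a : ℝ} (h1 : 1 < a) (h2 : a ≤ 2) (n : ℕ) :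
    0 ≤ grunwaldCoeff a (n + 2) := by
  induction n with
  | zero =>
    have := succ_mul_grunwaldCoeff_succ a 1
    rw [grunwaldCoeff_one] at this
    norm_num at this ⊢
    nlinarith
  | succ n ih =>
    have := succ_mul_grunwaldCoeff_succ a (n + 2)
    have h3 : 0 ≤ grunwaldCoeff a (n + 2) * (((n + 2 : ℕ) : ℝ) - a) := by
      apply mul_nonneg ih
      push_cast
      linarith [(Nat.cast_nonneg n : (0 : ℝ) ≤ n)]
    rw [← this] at h3
    exact nonneg_of_mul_nonneg_right h3 (by positivity)

theorem sum_grunwaldCoeff (a : ℝ) (n : ℕ) :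
    a * ∑ j ∈ Finset.range n, grunwaldCoeff a j = -(n * grunwaldCoeff a n) := by
  induction n with
  | zero => simp
  | succ n ih =>
    rw [Finset.sum_range_succ, mul_add, ih]
    have := succ_mul_grunwaldCoeff_succ a n
    push_cast
    rw [this]
    ring

theorem summable_grunwaldCoeff {a : ℝ} (h1 : 1 < a) (h2 : a ≤ 2) :
    Summable (fun n => ‖grunwaldCoeff a n‖) := by
  rw [← summable_nat_add_iff 2]
  have h : ∀ n, ‖grunwaldCoeff a (n + 2)‖ = grunwaldCoeff a (n + 2) := fun n =>
    Real.norm_of_nonneg (grunwaldCoeff_nonneg h1 h2 n)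
  simp only [h]
  -- The bound is -(1 - a), minus the two initial coefficients: by `sum_grunwaldCoeff` all partial
  -- sums of length at least 2 are nonpositive.
  refine summable_of_sum_range_le (c := a - 1) (grunwaldCoeff_nonneg h1 h2) fun n => ?_
  have hs := sum_grunwaldCoeff a (n + 2)
  rw [Finset.sum_range_succ', Finset.sum_range_succ', zero_add, grunwaldCoeff_zero,
    grunwaldCoeff_one] at hs
  have hn : 0 ≤ ((n + 2 : ℕ) : ℝ) * grunwaldCoeff a (n + 2) :=
    mul_nonneg (by positivity) (grunwaldCoeff_nonneg h1 h2 n)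
  nlinarith

/-- On the closed unit disc 1 - w meets the imaginary axis only at 0, so the branch cut matters only
there, where positivity of the exponent gives continuity. -/
theorem continuousAt_cpow_const_of_re_nonneg {a : ℝ} (ha : 0 < a) {z : ℂ} (hz : 0 ≤ z.re)
    (hz' : z.re = 0 → z = 0) : ContinuousAt (fun x : ℂ => x ^ (a : ℂ)) z := by
  rcases hz.lt_or_eq with h | h
  · exact continuousAt_cpow_const (Or.inl h)
  · rw [hz' h.symm]
    exact (Complex.continuousAt_cpow_zero_of_re_pos (z := (a : ℂ)) (by simpa using ha)).comp
      (f := fun x : ℂ => (x, (a : ℂ))) (by fun_prop)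

theorem re_one_sub_nonneg {w : ℂ} (hw : ‖w‖ ≤ 1) : 0 ≤ (1 - w).re := by
  have := Complex.re_le_norm w
  simp only [Complex.sub_re, Complex.one_re]
  linarith

theorem eq_one_of_re_one_sub {w : ℂ} (hw : ‖w‖ ≤ 1) (h : (1 - w).re = 0) : 1 - w = 0 := by
  have h1 : w.re = 1 := by
    simp only [Complex.sub_re, Complex.one_re] at h
    linarith
  have h2 : w.re * w.re + w.im * w.im ≤ 1 := by
    rw [← Complex.normSq_apply, Complex.normSq_eq_norm_sq]
    nlinarith [norm_nonneg w]
  have h3 : w.im = 0 := by rw [h1] at h2; nlinarith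
  apply Complex.ext <;> simp [h1, h3]

/-- Abel's argument: the identity holds at rw for r < 1, and r → 1 is taken by dominated convergence
on the series and by continuity of the power. -/
theorem hasSum_one_sub_cpow {a : ℝ} (h1 : 1 < a) (h2 : a ≤ 2) {w : ℂ} (hw : ‖w‖ ≤ 1) :
    HasSum (fun n : ℕ => (grunwaldCoeff a n : ℂ) * w ^ n) ((1 - w) ^ (a : ℂ)) := by
  have hsum := summable_grunwaldCoeff h1 h2
  have hbound : ∀ (n : ℕ) {v : ℂ}, ‖v‖ ≤ 1 →
      ‖(grunwaldCoeff a n : ℂ) * v ^ n‖ ≤ ‖grunwaldCoeff a n‖ := by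
    intro n v hv
    rw [norm_mul, norm_pow, Complex.norm_real]
    exact mul_le_of_le_one_right (norm_nonneg _) (pow_le_one₀ (norm_nonneg _) hv)
  have hin : ∀ {v : ℂ}, ‖v‖ < 1 →
      ∑' n, (grunwaldCoeff a n : ℂ) * v ^ n = (1 - v) ^ (a : ℂ) := by
    intro v hv
    have := (hasSum_one_add_cpow a (w := -v) (by simpa using hv)).tsum_eq
    rw [← sub_eq_add_neg] at this
    rw [← this]
    refine tsum_congr fun n => ?_
    rw [grunwaldCoeff, neg_pow v]
    push_cast
    ring
  have hs : Summable (fun n : ℕ => (grunwaldCoeff a n : ℂ) * w ^ n) :=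
    Summable.of_norm_bounded hsum fun n => hbound n hw
  rw [hs.hasSum_iff]
  have hr : Tendsto (fun r : ℝ => (r : ℂ) * w) (𝓝[<] 1) (𝓝 w) := by
    have : Continuous fun r : ℝ => (r : ℂ) * w := by fun_prop
    have := (this.tendsto 1).mono_left (nhdsWithin_le_nhds (s := Set.Iio 1))
    simpa using this
  have hev : ∀ᶠ r : ℝ in 𝓝[<] 1, ‖(r : ℂ) * w‖ < 1 := by
    filter_upwards [Ioo_mem_nhdsLT (show (0 : ℝ) < 1 by norm_num)] with r hr
    rw [norm_mul, Complex.norm_real, Real.norm_of_nonneg hr.1.le]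
    nlinarith [hr.1, hr.2, norm_nonneg w]
  have t1 : Tendsto (fun r : ℝ => ∑' n, (grunwaldCoeff a n : ℂ) * ((r : ℂ) * w) ^ n) (𝓝[<] 1)
      (𝓝 (∑' n, (grunwaldCoeff a n : ℂ) * w ^ n)) := by
    refine tendsto_tsum_of_dominated_convergence hsum (fun n => ?_) ?_
    · exact (hr.pow n).const_mul _
    · filter_upwards [hev] with r hr n using hbound n hr.le
  have t2 : Tendsto (fun r : ℝ => (1 - (r : ℂ) * w) ^ (a : ℂ)) (𝓝[<] 1)
      (𝓝 ((1 - w) ^ (a : ℂ))) := by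
    have := continuousAt_cpow_const_of_re_nonneg (a := a) (by linarith) (re_one_sub_nonneg hw)
      (eq_one_of_re_one_sub hw)
    exact this.tendsto.comp (tendsto_const_nhds.sub hr)
  refine tendsto_nhds_unique t1 (t2.congr' ?_)
  filter_upwards [hev] with r hr using (hin hr).symm

theorem summable_choose_mul_pow (a : ℝ) {q : ℝ} (hq0 : 0 ≤ q) (hq : q < 1) :
    Summable fun n : ℕ => ‖Ring.choose a n * q ^ n‖ := by
  have h := (hasSum_one_add_cpow a (w := (q : ℂ))
    (by rwa [Complex.norm_real, Real.norm_of_nonneg hq0])).summable.norm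
  refine h.congr fun n => ?_
  rw [← Complex.ofReal_pow, ← Complex.ofReal_mul, Complex.norm_real]

/-- Minus the reciprocal of the second root of the base of `genW α`. -/
def rootInv (α : ℝ) : ℝ := (2 - α) / (3 * α - 2)

/-- The constant term of the base of `genW α`. -/
def lead (α : ℝ) : ℝ := (3 * α - 2) / (2 * α)

theorem lead_pos {α : ℝ} (h1 : 1 < α) : 0 < lead α := by
  unfold lead
  apply div_pos <;> linarith

theorem rootInv_nonneg {α : ℝ} (h1 : 1 < α) (h2 : α ≤ 2) : 0 ≤ rootInv α := by
  unfold rootInv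
  apply div_nonneg <;> linarith

theorem rootInv_lt_one {α : ℝ} (h1 : 1 < α) : rootInv α < 1 := by
  unfold rootInv
  rw [div_lt_one] <;> linarith

theorem base_factor {α : ℝ} (h1 : 1 < α) (z : ℝ) :
    (3 * α - 2) / (2 * α) - 2 * (α - 1) / α * z + (α - 2) / (2 * α) * z ^ 2 =
      lead α * ((1 - z) * (1 + rootInv α * z)) := by
  have h3 : 3 * α - 2 ≠ 0 := by linarith
  have h4 : α ≠ 0 := by linarith
  unfold lead rootInv
  field_simp
  ring

/-- The coefficients of `genW α`, as a Cauchy product of two binomial series. -/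
def convCoeff (α : ℝ) (l : ℕ) : ℝ :=
  lead α ^ α * ∑ kl ∈ Finset.HasAntidiagonal.antidiagonal l,
    grunwaldCoeff α kl.1 * (Ring.choose α kl.2 * rootInv α ^ kl.2)

theorem summable_convCoeff {α : ℝ} (h1 : 1 < α) (h2 : α ≤ 2) :
    Summable fun l => ‖convCoeff α l‖ := by
  have := summable_norm_sum_mul_antidiagonal_of_summable_norm (summable_grunwaldCoeff h1 h2)
    (summable_choose_mul_pow α (rootInv_nonneg h1 h2) (rootInv_lt_one h1))
  simp only [convCoeff, norm_mul (lead α ^ α)]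
  exact this.mul_left _

/-- The complex generating function. -/
def genWC (α : ℝ) (w : ℂ) : ℂ :=
  ((lead α ^ α : ℝ) : ℂ) * ((1 - w) ^ (α : ℂ) * (1 + rootInv α * w) ^ (α : ℂ))

theorem hasSum_genWC {α : ℝ} (h1 : 1 < α) (h2 : α ≤ 2) {w : ℂ} (hw : ‖w‖ ≤ 1) :
    HasSum (fun l : ℕ => (convCoeff α l : ℂ) * w ^ l) (genWC α w) := by
  have hq0 := rootInv_nonneg h1 h2
  have hq1 := rootInv_lt_one h1
  have hb := hasSum_one_sub_cpow h1 h2 hw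
  have hd := hasSum_one_add_cpow α (w := (rootInv α : ℂ) * w) (by
    rw [norm_mul, Complex.norm_real, Real.norm_of_nonneg hq0]
    nlinarith [norm_nonneg w])
  have hs : Summable fun l : ℕ => (convCoeff α l : ℂ) * w ^ l := by
    refine Summable.of_norm_bounded (summable_convCoeff h1 h2) fun n => ?_
    rw [norm_mul, norm_pow, Complex.norm_real]
    exact mul_le_of_le_one_right (norm_nonneg _) (pow_le_one₀ (norm_nonneg _) hw)
  rw [hs.hasSum_iff, genWC, ← hb.tsum_eq, ← hd.tsum_eq,
    tsum_mul_tsum_eq_tsum_sum_antidiagonal_of_summable_norm hb.summable.norm hd.summable.norm,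
    ← tsum_mul_left]
  refine tsum_congr fun l => ?_
  rw [convCoeff]
  push_cast
  rw [mul_assoc, Finset.sum_mul]
  congr 1
  refine Finset.sum_congr rfl fun kl hkl => ?_
  rw [← Finset.HasAntidiagonal.mem_antidiagonal.1 hkl, pow_add, mul_pow]
  ring

theorem genWC_ofReal {α : ℝ} (h1 : 1 < α) (h2 : α ≤ 2) {z : ℝ} (hz : |z| ≤ 1) :
    genWC α (z : ℂ) = (genW α z : ℂ) := by
  have hq0 := rootInv_nonneg h1 h2
  have hq1 := rootInv_lt_one h1
  have hz' := abs_le.1 hz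
  have h3 : 0 ≤ 1 - z := by linarith
  have h4 : 0 ≤ 1 + rootInv α * z := by nlinarith
  rw [genW, base_factor h1, Real.mul_rpow (lead_pos h1).le (mul_nonneg h3 h4),
    Real.mul_rpow h3 h4, genWC]
  push_cast [Complex.ofReal_cpow h3, Complex.ofReal_cpow h4]
  rfl

/-- Uniqueness of power series: the Taylor coefficients at 0 must agree with the Cauchy product. -/
theorem kappa_eq_convCoeff {α : ℝ} (h1 : 1 < α) (h2 : α ≤ 2) (l : ℕ) :
    kappa α l = convCoeff α l := by
  have hp : HasFPowerSeriesAt (genW α) (FormalMultilinearSeries.ofScalars ℝ (convCoeff α)) 0 := by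
    rw [hasFPowerSeriesAt_iff]
    filter_upwards [Metric.ball_mem_nhds (0 : ℝ) one_pos] with z hz
    have hz' : |z| ≤ 1 := by simpa using (mem_ball_zero_iff.1 hz).le
    have h := hasSum_genWC h1 h2 (w := (z : ℂ)) (by rwa [Complex.norm_real])
    rw [genWC_ofReal h1 h2 hz'] at h
    norm_cast at h
    simpa [FormalMultilinearSeries.coeff_ofScalars, mul_comm] using h
  have h := hp.eq_formalMultilinearSeries hp.analyticAt.hasFPowerSeriesAt
  have := congrArg (fun p => FormalMultilinearSeries.coeff p l) h
  simp only [FormalMultilinearSeries.coeff_ofScalars] at this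
  exact this.symm

theorem summable_kappa {α : ℝ} (h1 : 1 < α) (h2 : α ≤ 2) : Summable fun l => ‖kappa α l‖ := by
  simpa only [kappa_eq_convCoeff h1 h2] using summable_convCoeff h1 h2

theorem hasSum_kappa_mul_pow {α : ℝ} (h1 : 1 < α) (h2 : α ≤ 2) {w : ℂ} (hw : ‖w‖ ≤ 1) :
    HasSum (fun l : ℕ => (kappa α l : ℂ) * w ^ l) (genWC α w) := by
  simpa only [kappa_eq_convCoeff h1 h2] using hasSum_genWC h1 h2 hw

end FracDiff

end

/-! ### The symbol e^z z^{-α} W(e^{-z}) near 0. -/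

noncomputable section

namespace FracDiff

open Filter Topology Asymptotics
open scoped Nat

/-- The two arguments add up to an angle strictly between -π and π, so the principal logarithm is
additive. -/
theorem mul_cpow_of_re {x y : ℂ} (hx : 0 ≤ x.re) (hy : 0 < y.re) (a : ℂ) :
    (x * y) ^ a = x ^ a * y ^ a := by
  have hy0 : y ≠ 0 := fun h => by simp [h] at hy
  by_cases hx0 : x = 0
  · by_cases ha : a = 0
    · simp [ha]
    · simp [hx0, Complex.zero_cpow ha]
  have h1 := abs_le.1 (Complex.abs_arg_le_pi_div_two_iff.2 hx)
  have h2 := abs_lt.1 (Complex.abs_arg_lt_pi_div_two_iff.2 (Or.inl hy))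
  rw [Complex.cpow_def_of_ne_zero (mul_ne_zero hx0 hy0), Complex.cpow_def_of_ne_zero hx0,
    Complex.cpow_def_of_ne_zero hy0, Complex.log_mul hx0 hy0 ⟨by linarith, by linarith⟩, add_mul,
    Complex.exp_add]

/-- The base of `genW α` at `exp (-z)`, factored. -/
def symBase (α : ℝ) (z : ℂ) : ℂ :=
  lead α * ((1 - Complex.exp (-z)) * (1 + rootInv α * Complex.exp (-z)))

/-- The quotient `symBase α z / z`, extended to `z = 0`. -/
def symQuot (α : ℝ) : ℂ → ℂ := dslope (symBase α) 0

/-- The symbol `exp z * (symBase α z / z) ^ α`. -/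
def symbol (α : ℝ) (z : ℂ) : ℂ := Complex.exp z * symQuot α z ^ (α : ℂ)

theorem symBase_zero (α : ℝ) : symBase α 0 = 0 := by simp [symBase]

theorem mul_symQuot (α : ℝ) (z : ℂ) : z * symQuot α z = symBase α z := by
  have := sub_smul_dslope (symBase α) 0 z
  simpa [symBase_zero, symQuot] using this

theorem differentiable_symBase (α : ℝ) : Differentiable ℂ (symBase α) := by
  unfold symBase; fun_prop

theorem analyticAt_symQuot (α : ℝ) : AnalyticAt ℂ (symQuot α) 0 := by
  obtain ⟨p, hp⟩ := (differentiable_symBase α).analyticAt 0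
  exact ⟨_, hp.has_fpower_series_dslope_fslope⟩

theorem lead_mul_one_add {α : ℝ} (h1 : 1 < α) : lead α * (1 + rootInv α) = 1 := by
  have h3 : 3 * α - 2 ≠ 0 := by linarith
  have h4 : α ≠ 0 := by linarith
  unfold lead rootInv
  field_simp
  ring

theorem symQuot_zero {α : ℝ} (h1 : 1 < α) : symQuot α 0 = 1 := by
  rw [symQuot, dslope_same]
  have he : HasDerivAt (fun z : ℂ => Complex.exp (-z)) (-1) 0 := by
    simpa using ((hasDerivAt_id (0 : ℂ)).neg).cexp
  have := (((he.const_sub 1).mul ((he.const_mul (rootInv α : ℂ)).const_add 1)).const_mul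
    (lead α : ℂ)).deriv
  have h := lead_mul_one_add h1
  have h' : (lead α : ℂ) * (1 + rootInv α) = 1 := by exact_mod_cast h
  refine Eq.trans this ?_
  simpa using h'

theorem analyticAt_symbol {α : ℝ} (h1 : 1 < α) : AnalyticAt ℂ (symbol α) 0 := by
  refine (Complex.differentiable_exp.analyticAt 0).mul ?_
  exact (analyticAt_symQuot α).cpow analyticAt_const (by simp [symQuot_zero h1])

/-- Powers may be multiplied because z and 1 - e^{-z} have nonnegative real part, while the
remaining factors are close to positive reals. The imaginary axis is included, which is where the
identity gets used. -/
theorem eventually_symbol {α : ℝ} (h1 : 1 < α) (h2 : α ≤ 2) :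
    ∀ᶠ z : ℂ in 𝓝 0, 0 ≤ z.re →
      Complex.exp z * genWC α (Complex.exp (-z)) = z ^ (α : ℂ) * symbol α z := by
  have hq0 := rootInv_nonneg h1 h2
  have hl := lead_pos h1
  have hQ : ∀ᶠ z in 𝓝 0, 0 < (symQuot α z).re := by
    have := (Complex.continuous_re.continuousAt.comp (analyticAt_symQuot α).continuousAt)
    refine this.eventually (lt_mem_nhds ?_)
    simp [symQuot_zero h1]
  have hA : ∀ᶠ z : ℂ in 𝓝 0, 0 < (1 + rootInv α * Complex.exp (-z)).re := by
    have : Continuous fun z : ℂ => (1 + rootInv α * Complex.exp (-z)).re := by fun_prop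
    refine this.continuousAt.eventually (lt_mem_nhds ?_)
    simp
    linarith
  filter_upwards [hQ, hA] with z hQ hA hz
  have hw : ‖Complex.exp (-z)‖ ≤ 1 := by
    rw [Complex.norm_exp]
    simpa using hz
  have hA' : 0 < (lead α * (1 + rootInv α * Complex.exp (-z))).re := by
    rw [Complex.re_ofReal_mul]
    positivity
  have hl' : ((lead α ^ α : ℝ) : ℂ) = (lead α : ℂ) ^ (α : ℂ) := Complex.ofReal_cpow hl.le α
  rw [genWC, symbol, mul_left_comm (z ^ (α : ℂ)), ← mul_cpow_of_re hz hQ, mul_symQuot, symBase,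
    mul_left_comm (lead α : ℂ), mul_cpow_of_re (re_one_sub_nonneg hw) hA',
    mul_cpow_of_re (by simpa using hl.le) hA, hl']
  ring

theorem symbol_ofReal {α : ℝ} (h1 : 1 < α) (h2 : α ≤ 2) {z : ℝ} (hz : 0 < z) :
    symbol α (z : ℂ) = ((Real.exp z / z ^ α * genW α (Real.exp (-z)) : ℝ) : ℂ) := by
  have hq0 := rootInv_nonneg h1 h2
  have hl := lead_pos h1
  have hB : 0 ≤ lead α * ((1 - Real.exp (-z)) * (1 + rootInv α * Real.exp (-z))) := by
    have : Real.exp (-z) ≤ 1 := by simpa using hz.le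
    have h3 : 0 ≤ 1 - Real.exp (-z) := by linarith
    positivity
  have hQ : symQuot α (z : ℂ) =
      ((lead α * ((1 - Real.exp (-z)) * (1 + rootInv α * Real.exp (-z))) / z : ℝ) : ℂ) := by
    have hz' : (z : ℂ) ≠ 0 := by exact_mod_cast hz.ne'
    have := mul_symQuot α z
    rw [symBase] at this
    push_cast
    rw [eq_div_iff hz', mul_comm, this]
  rw [symbol, hQ, ← Complex.ofReal_cpow (div_nonneg hB hz.le), Real.div_rpow hB hz.le, genW,
    base_factor h1]
  push_cast
  ring

/-! ### Expansion of the symbol to third order -/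

/-- `f z = a + b z + c z² + d z³ + O(z⁴)` as `z → 0`, `z ≠ 0`. -/
def CubicExpansion (f : ℂ → ℂ) (a b c d : ℂ) : Prop :=
  (fun z => f z - (a + b * z + c * z ^ 2 + d * z ^ 3)) =O[𝓝[≠] 0] fun z => z ^ 4

theorem isBigO_one_of_continuous {f : ℂ → ℂ} (hf : ContinuousAt f 0) :
    f =O[𝓝[≠] 0] fun _ => (1 : ℂ) :=
  (hf.isBigO_one ℂ).mono nhdsWithin_le_nhds

theorem isBigO_pow_mul {f : ℂ → ℂ} (hf : ContinuousAt f 0) (n : ℕ) :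
    (fun z => z ^ n * f z) =O[𝓝[≠] 0] fun z : ℂ => z ^ n := by
  simpa using (isBigO_refl (fun z : ℂ => z ^ n) (𝓝[≠] 0)).mul (isBigO_one_of_continuous hf)

namespace CubicExpansion

variable {f g : ℂ → ℂ} {a b c d a' b' c' d' : ℂ}

theorem isBigO_one (hf : CubicExpansion f a b c d) : f =O[𝓝[≠] 0] fun _ => (1 : ℂ) := by
  have h1 := hf.trans (isBigO_one_of_continuous (f := fun z : ℂ => z ^ 4) (by fun_prop))
  have h2 := isBigO_one_of_continuous (f := fun z : ℂ => a + b * z + c * z ^ 2 + d * z ^ 3)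
    (by fun_prop)
  exact (h1.add h2).congr_left fun z => by ring

theorem add (hf : CubicExpansion f a b c d) (hg : CubicExpansion g a' b' c' d') :
    CubicExpansion (fun z => f z + g z) (a + a') (b + b') (c + c') (d + d') :=
  (IsBigO.add hf hg).congr_left fun z => by ring

theorem const_mul (hf : CubicExpansion f a b c d) (k : ℂ) :
    CubicExpansion (fun z => k * f z) (k * a) (k * b) (k * c) (k * d) :=
  (IsBigO.const_mul_left hf k).congr_left fun z => by ring

theorem mul (hf : CubicExpansion f a b c d) (hg : CubicExpansion g a' b' c' d') :
    CubicExpansion (fun z => f z * g z) (a * a') (a * b' + b * a') (a * c' + b * b' + c * a')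
      (a * d' + b * c' + c * b' + d * a') := by
  have h1 := IsBigO.mul hf hg.isBigO_one
  have h2 := (isBigO_one_of_continuous (f := fun z : ℂ => a + b * z + c * z ^ 2 + d * z ^ 3)
    (by fun_prop)).mul hg
  have h3 := isBigO_pow_mul (f := fun z : ℂ => (b * d' + c * c' + d * b') + (c * d' + d * c') * z +
    d * d' * z ^ 2) (by fun_prop) 4
  simp only [mul_one, one_mul] at h1 h2
  exact ((h1.add h2).add h3).congr_left fun z => by ring

/-- Coefficients of the difference are peeled off one at a time: let z → 0 to kill the constant
term, then divide by z. -/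
theorem unique (hf : CubicExpansion f a b c d) (hg : CubicExpansion f a' b' c' d') :
    a = a' ∧ b = b' ∧ c = c' ∧ d = d' := by
  have step : ∀ {f : ℂ → ℂ} {k : ℂ} {n : ℕ}, ContinuousAt f 0 →
      (fun z => k + z * f z) =O[𝓝[≠] 0] (fun z => z ^ (n + 1)) →
      k = 0 ∧ f =O[𝓝[≠] 0] (fun z => z ^ n) := by
    intro f k n hf h
    have h1 : Tendsto (fun z : ℂ => z ^ (n + 1)) (𝓝[≠] 0) (𝓝 0) := by
      have : Continuous fun z : ℂ => z ^ (n + 1) := by fun_prop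
      simpa using (this.tendsto 0).mono_left nhdsWithin_le_nhds
    have h2 : Tendsto (fun z => k + z * f z) (𝓝[≠] 0) (𝓝 (k + 0 * f 0)) :=
      (tendsto_const_nhds.add (tendsto_id.mul hf.tendsto)).mono_left nhdsWithin_le_nhds
    have hk : k = 0 := by
      simpa using tendsto_nhds_unique h2 (h.trans_tendsto h1)
    subst hk
    refine ⟨rfl, ((isBigO_refl (fun z : ℂ => z⁻¹) (𝓝[≠] 0)).mul h).congr' ?_ ?_⟩
    · filter_upwards [self_mem_nhdsWithin] with z hz
      rw [zero_add, inv_mul_cancel_left₀ hz]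
    · filter_upwards [self_mem_nhdsWithin] with z hz
      rw [pow_succ', inv_mul_cancel_left₀ hz]
  have h0 := IsBigO.sub hg hf
  have h1 := step (k := a - a') (n := 3)
    (f := fun z => (b - b') + z * ((c - c') + z * ((d - d') + z * 0))) (by fun_prop)
    (h0.congr_left fun z => by ring)
  have h2 := step (n := 2) (by fun_prop) h1.2
  have h3 := step (n := 1) (by fun_prop) h2.2
  have h4 := step (n := 0) (by fun_prop) h3.2
  exact ⟨sub_eq_zero.1 h1.1, sub_eq_zero.1 h2.1, sub_eq_zero.1 h3.1, sub_eq_zero.1 h4.1⟩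

theorem of_sub (hf : CubicExpansion f a b c d) (h : (fun z => g z - f z) =O[𝓝[≠] 0] fun z => z ^ 4) :
    CubicExpansion g a b c d :=
  (IsBigO.add h hf).congr_left fun z => by ring

end CubicExpansion

theorem cubicExpansion_const (k : ℂ) : CubicExpansion (fun _ => k) k 0 0 0 :=
  (isBigO_zero _ _).congr_left fun z => by ring

theorem cubicExpansion_exp : CubicExpansion Complex.exp 1 1 (1 / 2) (1 / 6) := by
  refine ((Complex.exp_sub_sum_range_isBigO_pow 4).mono nhdsWithin_le_nhds).congr_left fun z => ?_
  simp [Finset.sum_range_succ, Nat.factorial]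
  ring

theorem cubicExpansion_of_hasFPowerSeriesAt {f : ℂ → ℂ} {p : FormalMultilinearSeries ℂ ℂ ℂ}
    (hp : HasFPowerSeriesAt f p 0) :
    CubicExpansion f (p.coeff 0) (p.coeff 1) (p.coeff 2) (p.coeff 3) := by
  have h := (hp.isBigO_sub_partialSum_pow 4).mono (nhdsWithin_le_nhds (s := {0}ᶜ))
  refine IsBigO.trans (IsBigO.congr_left h fun z => ?_) (isBigO_of_le _ fun z => by simp)
  simp [FormalMultilinearSeries.partialSum, Finset.sum_range_succ]
  ring

theorem cubicExpansion_symQuot {α : ℝ} (h1 : 1 < α) :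
    CubicExpansion (symQuot α) 1 (-(1 / α)) ((3 - α) / (3 * α)) ((3 * α - 7) / (12 * α)) := by
  have hα : (α : ℂ) ≠ 0 := by
    have : α ≠ 0 := by linarith
    exact_mod_cast this
  -- The exponentials are expanded one order further than the target, since division by z loses one.
  have hexp : ∀ k : ℂ, (fun z => Complex.exp (k * z) - ∑ i ∈ Finset.range 5, (k * z) ^ i / i !)
      =O[𝓝[≠] 0] fun z => z ^ 5 := by
    intro k
    have ht : Tendsto (fun z : ℂ => k * z) (𝓝[≠] 0) (𝓝 0) := by
      have : Continuous fun z : ℂ => k * z := by fun_prop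
      simpa using (this.tendsto 0).mono_left nhdsWithin_le_nhds
    refine ((Complex.exp_sub_sum_range_isBigO_pow 5).comp_tendsto ht).trans ?_
    refine (IsBigO.const_mul_left (isBigO_refl (fun z : ℂ => z ^ 5) _) (k ^ 5)).congr_left
      fun z => ?_
    simp [mul_pow]
  have hB : ∀ z, symBase α z = (3 * α - 2) / (2 * α) - 2 * (α - 1) / α * Complex.exp (-1 * z) +
      (α - 2) / (2 * α) * Complex.exp (-2 * z) := by
    intro z
    have h3 : (3 * α - 2 : ℂ) ≠ 0 := by
      have : 3 * α - 2 ≠ 0 := by linarith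
      exact_mod_cast this
    rw [symBase, lead, rootInv, show (-2 : ℂ) * z = -z + -z by ring, Complex.exp_add, neg_one_mul]
    push_cast
    field_simp
    ring
  have h5 := ((hexp (-1)).const_mul_left (-(2 * (α - 1) / α))).add
    ((hexp (-2)).const_mul_left ((α - 2) / (2 * α)))
  refine ((isBigO_refl (fun z : ℂ => z⁻¹) (𝓝[≠] 0)).mul h5).congr' ?_ ?_
  · filter_upwards [self_mem_nhdsWithin] with z hz
    have hz' : z ≠ 0 := hz
    have hq : symQuot α z = z⁻¹ * symBase α z := by
      rw [← mul_symQuot, inv_mul_cancel_left₀ hz']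
    rw [hq, hB]
    simp only [Finset.sum_range_succ, Finset.sum_range_zero, Nat.factorial]
    push_cast
    field_simp
    ring
  · filter_upwards [self_mem_nhdsWithin] with z hz
    rw [pow_succ' z 4, inv_mul_cancel_left₀ hz]

theorem binomial_isBigO (α : ℝ) :
    (fun x : ℂ => (1 + x) ^ (α : ℂ) - (1 + α * x + α * (α - 1) / 2 * x ^ 2 +
      α * (α - 1) * (α - 2) / 6 * x ^ 3)) =O[𝓝 0] fun x => x ^ 4 := by
  have h := (Complex.one_add_cpow_hasFPowerSeriesAt_zero (a := (α : ℂ))).isBigO_sub_partialSum_pow 4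
  refine IsBigO.trans (IsBigO.congr_left h fun z => ?_) (isBigO_of_le _ fun z => by simp)
  have c2 : Ring.choose α 2 = α * (α - 1) / 2 := by
    have := succ_mul_choose_succ α 1
    norm_num at this
    linarith
  have c3 : Ring.choose α 3 = α * (α - 1) * (α - 2) / 6 := by
    have := succ_mul_choose_succ α 2
    norm_num [c2] at this
    linarith
  simp [FormalMultilinearSeries.partialSum, Finset.sum_range_succ, binomialSeries,
    FormalMultilinearSeries.coeff_ofScalars, ← Complex.ofReal_choose, c2, c3]
  ring

/-- The quotient is 1 + x with x = O(z), so the binomial remainder O(x⁴) is O(z⁴); the rest is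
multiplication of cubic polynomials. -/
theorem cubicExpansion_symbol {α : ℝ} (h1 : 1 < α) :
    CubicExpansion (symbol α) 1 0 ((-((2 * α ^ 2 - 6 * α + 3) / (6 * α)) : ℝ))
      (((3 * α ^ 3 - 11 * α ^ 2 + 12 * α - 4) / (12 * α ^ 2) : ℝ)) := by
  have hα : (α : ℂ) ≠ 0 := by
    have : α ≠ 0 := by linarith
    exact_mod_cast this
  have hQ := cubicExpansion_symQuot h1
  have hx := hQ.add (cubicExpansion_const (-1))
  have hx2 := hx.mul hx
  have hx3 := hx.mul hx2
  have hS := (((cubicExpansion_const 1).add (hx.const_mul α)).add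
    (hx2.const_mul (α * (α - 1) / 2))).add (hx3.const_mul (α * (α - 1) * (α - 2) / 6))
  have ht : Tendsto (fun z => symQuot α z + -1) (𝓝[≠] 0) (𝓝 0) := by
    have := ((analyticAt_symQuot α).continuousAt.tendsto.add
      (tendsto_const_nhds (x := (-1 : ℂ)))).mono_left (nhdsWithin_le_nhds (s := {0}ᶜ))
    rwa [symQuot_zero h1, add_neg_cancel] at this
  have hxO : (fun z => symQuot α z + -1) =O[𝓝[≠] 0] fun z => z := by
    have h2 := hx.trans (isBigO_pow_mul (f := fun z : ℂ => z ^ 3) (by fun_prop) 1 |>.congr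
      (fun z => by ring) (fun z => by rw [pow_one]) : (fun z : ℂ => z ^ 4) =O[𝓝[≠] 0] fun z => z)
    have h3 := isBigO_pow_mul (f := fun z : ℂ => (-(1 / α)) + ((3 - α) / (3 * α)) * z +
      ((3 * α - 7) / (12 * α)) * z ^ 2) (by fun_prop) 1
    simp only [pow_one] at h3
    exact (h2.add h3).congr_left fun z => by ring
  have hbin := ((binomial_isBigO α).comp_tendsto ht).trans (hxO.pow 4)
  have hpow := hS.of_sub (g := fun z => symQuot α z ^ (α : ℂ)) (hbin.congr_left fun z => by
    simp only [Function.comp]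
    rw [show 1 + (symQuot α z + -1) = symQuot α z by ring]
    ring)
  have h := cubicExpansion_exp.mul hpow
  unfold symbol
  convert h using 1
  · ring
  · field_simp
    ring
  · push_cast
    field_simp
    ring
  · push_cast
    field_simp
    ring

/-! ### The expansion coefficients are real -/

/-- On the real axis the imaginary part of the symbol is real analytic and vanishes for x > 0, hence
identically near 0; its coefficients are the imaginary parts of those of the symbol. -/
theorem exists_symbol_coeff {α : ℝ} (h1 : 1 < α) (h2 : α ≤ 2) :
    ∃ γ : ℕ → ℝ, HasFPowerSeriesAt (symbol α)
      (FormalMultilinearSeries.ofScalars ℂ fun l => (γ l : ℂ)) 0 := by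
  obtain ⟨p, hp⟩ := analyticAt_symbol h1
  have him : HasFPowerSeriesAt (fun x : ℝ => (symbol α x).im)
      (FormalMultilinearSeries.ofScalars ℝ fun l => (p.coeff l).im) 0 := by
    rw [hasFPowerSeriesAt_iff] at hp ⊢
    have ht : Tendsto (fun x : ℝ => (x : ℂ)) (𝓝 0) (𝓝 0) := by
      simpa using Complex.continuous_ofReal.tendsto 0
    filter_upwards [ht.eventually hp] with x hx
    have := Complex.hasSum_im hx
    simp only [zero_add, FormalMultilinearSeries.coeff_ofScalars, smul_eq_mul] at this ⊢
    have hl : ∀ l, ((x : ℂ) ^ l * p.coeff l).im = x ^ l * (p.coeff l).im := fun l => by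
      rw [← Complex.ofReal_pow, Complex.im_ofReal_mul]
    simpa only [hl] using this
  have h0 : ∀ l, (p.coeff l).im = 0 := by
    have hz : ∃ᶠ x : ℝ in 𝓝[≠] 0, (symbol α x).im = 0 := by
      refine Filter.Frequently.filter_mono ?_ (nhdsWithin_mono 0 (s := Set.Ioi 0) fun x hx => hx.ne')
      refine Filter.Eventually.frequently ?_
      filter_upwards [self_mem_nhdsWithin] with x hx
      rw [symbol_ofReal h1 h2 hx, Complex.ofReal_im]
    have hev := him.analyticAt.frequently_zero_iff_eventually_zero.1 hz
    have := (him.congr hev).eq_zero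
    intro l
    have := congrArg (fun q => FormalMultilinearSeries.coeff q l) this
    rw [FormalMultilinearSeries.coeff_ofScalars] at this
    exact this.trans (FormalMultilinearSeries.coeff_eq_zero.2 rfl)
  refine ⟨fun l => (p.coeff l).re, ?_⟩
  rw [hasFPowerSeriesAt_iff] at hp ⊢
  filter_upwards [hp] with z hz
  convert hz using 3 with l
  rw [FormalMultilinearSeries.coeff_ofScalars]
  exact Complex.ext (by simp) (by simp [h0 l])

theorem hasSum_symbol {α : ℝ} {γ : ℕ → ℝ} (hγ : HasFPowerSeriesAt (symbol α)
      (FormalMultilinearSeries.ofScalars ℂ fun l => (γ l : ℂ)) 0) :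
    ∀ᶠ z : ℂ in 𝓝 0, HasSum (fun l => (γ l : ℂ) * z ^ l) (symbol α z) := by
  filter_upwards [hasFPowerSeriesAt_iff.1 hγ] with z hz
  simpa [FormalMultilinearSeries.coeff_ofScalars, mul_comm] using hz

theorem isSymbolExpansion {α : ℝ} (h1 : 1 < α) (h2 : α ≤ 2) {γ : ℕ → ℝ}
    (hγ : HasFPowerSeriesAt (symbol α)
      (FormalMultilinearSeries.ofScalars ℂ fun l => (γ l : ℂ)) 0) : IsSymbolExpansion α γ := by
  obtain ⟨r, hr, h⟩ := Metric.eventually_nhds_iff.1 (hasSum_symbol hγ)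
  refine ⟨r, hr, fun z hz hzr => ?_⟩
  have := h (y := (z : ℂ)) (by simpa [abs_of_pos hz] using hzr)
  rw [symbol_ofReal h1 h2 hz] at this
  exact_mod_cast this

theorem symbol_coeff_values {α : ℝ} (h1 : 1 < α) {γ : ℕ → ℝ}
    (hγ : HasFPowerSeriesAt (symbol α)
      (FormalMultilinearSeries.ofScalars ℂ fun l => (γ l : ℂ)) 0) :
    γ 0 = 1 ∧ γ 1 = 0 ∧ γ 2 = -((2 * α ^ 2 - 6 * α + 3) / (6 * α)) ∧
      γ 3 = (3 * α ^ 3 - 11 * α ^ 2 + 12 * α - 4) / (12 * α ^ 2) := by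
  have h := (cubicExpansion_of_hasFPowerSeriesAt hγ).unique (cubicExpansion_symbol h1)
  simp only [FormalMultilinearSeries.coeff_ofScalars] at h
  exact ⟨by exact_mod_cast h.1, by exact_mod_cast h.2.1, by exact_mod_cast h.2.2.1,
    by exact_mod_cast h.2.2.2⟩

/-! ### Error of the truncated symbol on the imaginary axis. -/

theorem norm_genWC_le {α : ℝ} (h1 : 1 < α) (h2 : α ≤ 2) {w : ℂ} (hw : ‖w‖ ≤ 1) :
    ‖genWC α w‖ ≤ ∑' l, ‖kappa α l‖ := by
  rw [← (hasSum_kappa_mul_pow h1 h2 hw).tsum_eq]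
  refine tsum_of_norm_bounded (summable_kappa h1 h2).hasSum fun l => ?_
  rw [norm_mul, norm_pow, Complex.norm_real]
  exact mul_le_of_le_one_right (norm_nonneg _) (pow_le_one₀ (norm_nonneg _) hw)

theorem exists_symbol_bound {α : ℝ} (h1 : 1 < α) (h2 : α ≤ 2) {γ : ℕ → ℝ}
    (hγ : HasFPowerSeriesAt (symbol α)
      (FormalMultilinearSeries.ofScalars ℂ fun l => (γ l : ℂ)) 0) (n : ℕ) :
    ∃ C : ℝ, ∀ z : ℂ, z.re = 0 →
      ‖Complex.exp z * genWC α (Complex.exp (-z)) -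
        z ^ (α : ℂ) * ∑ l ∈ Finset.range n, (γ l : ℂ) * z ^ l‖ ≤ C * ‖z‖ ^ (α + n) := by
  obtain ⟨C₁, hC₁, hO⟩ := (hγ.isBigO_sub_partialSum_pow n).exists_pos
  obtain ⟨r, hr, hnear⟩ := Metric.eventually_nhds_iff.1
    (hO.bound.and (eventually_symbol h1 h2))
  set K := ∑' l, ‖kappa α l‖ with hK
  have hK0 : 0 ≤ K := tsum_nonneg fun _ => norm_nonneg _
  -- For |z| ≥ r, the first summand absorbs the bounded W and the second the polynomial, by |z|^l ≤
  -- |z|^n / r^(n-l).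
  set C₂ := K / r ^ (α + n) + ∑ l ∈ Finset.range n, |γ l| / r ^ (n - l) with hC₂
  have hC₂0 : 0 ≤ C₂ := by positivity
  refine ⟨C₁ + C₂, fun z hz => ?_⟩
  have hpow : ‖z‖ ^ (α + n) = ‖z‖ ^ α * ‖z‖ ^ n := by
    rw [Real.rpow_add_of_nonneg (norm_nonneg _) (by linarith) (by positivity), Real.rpow_natCast]
  rcases lt_or_ge ‖z‖ r with hzr | hzr
  · obtain ⟨hb, hs⟩ := hnear (y := z) (by simpa using hzr)
    have hp : (FormalMultilinearSeries.ofScalars ℂ fun l => (γ l : ℂ)).partialSum n z =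
        ∑ l ∈ Finset.range n, (γ l : ℂ) * z ^ l := by
      simp [FormalMultilinearSeries.partialSum, FormalMultilinearSeries.coeff_ofScalars, mul_comm]
    rw [hs hz.ge, ← mul_sub, norm_mul, Complex.norm_cpow_real, hpow]
    rw [hp, zero_add, norm_pow, norm_norm] at hb
    calc ‖z‖ ^ α * ‖symbol α z - ∑ l ∈ Finset.range n, (γ l : ℂ) * z ^ l‖
        ≤ ‖z‖ ^ α * (C₁ * ‖z‖ ^ n) := by gcongr
      _ = C₁ * (‖z‖ ^ α * ‖z‖ ^ n) := by ring
      _ ≤ _ := by gcongr; linarith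
  · have hexp : ‖Complex.exp z‖ = 1 := by rw [Complex.norm_exp, hz, Real.exp_zero]
    have hexp' : ‖Complex.exp (-z)‖ ≤ 1 := by rw [Complex.norm_exp, Complex.neg_re, hz]; simp
    have hA : ‖Complex.exp z * genWC α (Complex.exp (-z))‖ ≤ K / r ^ (α + n) * ‖z‖ ^ (α + n) := by
      rw [norm_mul, hexp, one_mul]
      refine (norm_genWC_le h1 h2 hexp').trans ?_
      rw [div_mul_eq_mul_div, le_div_iff₀ (by positivity)]
      gcongr
    have hB : ‖z ^ (α : ℂ) * ∑ l ∈ Finset.range n, (γ l : ℂ) * z ^ l‖ ≤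
        (∑ l ∈ Finset.range n, |γ l| / r ^ (n - l)) * ‖z‖ ^ (α + n) := by
      rw [norm_mul, Complex.norm_cpow_real, hpow, mul_left_comm]
      gcongr
      rw [Finset.sum_mul]
      refine norm_sum_le_of_le _ fun l hl => ?_
      rw [norm_mul, norm_pow, Complex.norm_real, Real.norm_eq_abs, div_mul_eq_mul_div,
        le_div_iff₀ (by positivity), mul_assoc]
      gcongr
      calc ‖z‖ ^ l * r ^ (n - l) ≤ ‖z‖ ^ l * ‖z‖ ^ (n - l) := by gcongr
        _ = ‖z‖ ^ n := by rw [← pow_add, Nat.add_sub_cancel' (Finset.mem_range.1 hl).le]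
    refine (norm_sub_le _ _).trans ((add_le_add hA hB).trans ?_)
    rw [← add_mul, ← hC₂]
    gcongr
    linarith

end FracDiff

end

noncomputable section

namespace FracDiff

open Filter Topology FourierTransform Complex
open scoped Nat Real

/-! ### The Gamma integral with complex rate -/

theorem integrableOn_rpow_mul_exp {s ε : ℝ} (hs : 0 < s) (hε : 0 < ε) :
    IntegrableOn (fun t : ℝ => t ^ (s - 1) * Real.exp (-(ε * t))) (Set.Ioi 0) := by
  have := integrableOn_rpow_mul_exp_neg_mul_rpow (p := 1) (s := s - 1) (b := ε) (by linarith)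
    one_pos hε
  simpa using this

theorem norm_rpow_mul_cexp (s : ℝ) {t : ℝ} (ht : 0 < t) (r : ℂ) :
    ‖((t ^ (s - 1) : ℝ) : ℂ) * cexp (-(r * t))‖ = t ^ (s - 1) * Real.exp (-(r.re * t)) := by
  rw [norm_mul, norm_real, Real.norm_of_nonneg (by positivity), norm_exp]
  simp

theorem measurable_rpow_mul_cexp (s : ℝ) (r : ℂ) :
    Measurable fun t : ℝ => ((t ^ (s - 1) : ℝ) : ℂ) * cexp (-(r * t)) := by
  fun_prop

theorem integrableOn_rpow_mul_cexp {s : ℝ} (hs : 0 < s) {r : ℂ} (hr : 0 < r.re) :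
    IntegrableOn (fun t : ℝ => ((t ^ (s - 1) : ℝ) : ℂ) * cexp (-(r * t))) (Set.Ioi 0) := by
  refine (integrableOn_rpow_mul_exp hs hr).mono' (measurable_rpow_mul_cexp s r).aestronglyMeasurable
    ?_
  filter_upwards [ae_restrict_mem measurableSet_Ioi] with t ht
  exact (norm_rpow_mul_cexp s ht r).le

theorem differentiableAt_gammaIntegral {s : ℝ} (hs : 0 < s) {r : ℂ} (hr : 0 < r.re) :
    DifferentiableAt ℂ
      (fun r : ℂ => ∫ t in Set.Ioi (0 : ℝ), ((t ^ (s - 1) : ℝ) : ℂ) * cexp (-(r * t))) r := by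
  have hmem : {z : ℂ | r.re / 2 < z.re} ∈ 𝓝 r :=
    (isOpen_lt continuous_const continuous_re).mem_nhds (by simpa using half_lt_self hr)
  refine (hasDerivAt_integral_of_dominated_loc_of_deriv_le (𝕜 := ℂ) (s := {z : ℂ | r.re / 2 < z.re})
    (F' := fun r t => -(((t ^ ((s + 1) - 1) : ℝ) : ℂ) * cexp (-(r * t))))
    (bound := fun t : ℝ => t ^ ((s + 1) - 1) * Real.exp (-(r.re / 2 * t)))
    hmem (Eventually.of_forall fun z => (measurable_rpow_mul_cexp s z).aestronglyMeasurable)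
    (integrableOn_rpow_mul_cexp hs hr)
    (measurable_rpow_mul_cexp (s + 1) r).neg.aestronglyMeasurable ?_
    (integrableOn_rpow_mul_exp (by linarith) (by linarith)) ?_).2.differentiableAt
  · filter_upwards [ae_restrict_mem measurableSet_Ioi] with t ht z hz
    have ht' : 0 < t := ht
    rw [norm_neg, norm_rpow_mul_cexp _ ht]
    have hz' : r.re / 2 < z.re := hz
    gcongr
  · filter_upwards [ae_restrict_mem measurableSet_Ioi] with t ht z _
    have ht' : 0 < t := ht
    have h := (((hasDerivAt_id z).mul_const (t : ℂ)).neg.cexp).const_mul ((t ^ (s - 1) : ℝ) : ℂ)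
    refine h.congr_deriv ?_
    change ((t ^ (s - 1) : ℝ) : ℂ) * (cexp (-(z * t)) * -(1 * t)) = _
    rw [show s + 1 - 1 = (s - 1) + 1 by ring, Real.rpow_add_one ht'.ne']
    push_cast
    ring

/-- Both sides are analytic in r on the right half-plane and agree for real r > 1 by the real Gamma
integral, so the identity theorem applies. -/
theorem integral_rpow_mul_cexp {s : ℝ} (hs : 0 < s) {r : ℂ} (hr : 0 < r.re) :
    ∫ t in Set.Ioi (0 : ℝ), ((t ^ (s - 1) : ℝ) : ℂ) * cexp (-(r * t)) =
      (Real.Gamma s : ℂ) * r ^ (-(s : ℂ)) := by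
  have hU : IsOpen {z : ℂ | 0 < z.re} := isOpen_lt continuous_const continuous_re
  have h1 : AnalyticOnNhd ℂ
      (fun r : ℂ => ∫ t in Set.Ioi (0 : ℝ), ((t ^ (s - 1) : ℝ) : ℂ) * cexp (-(r * t)))
      {z : ℂ | 0 < z.re} :=
    DifferentiableOn.analyticOnNhd
      (fun z hz => (differentiableAt_gammaIntegral hs hz).differentiableWithinAt) hU
  have h2 : AnalyticOnNhd ℂ (fun r : ℂ => (Real.Gamma s : ℂ) * r ^ (-(s : ℂ)))
      {z : ℂ | 0 < z.re} := fun z hz =>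
    analyticAt_const.mul (analyticAt_id.cpow analyticAt_const (Or.inl hz))
  refine h1.eqOn_of_preconnected_of_frequently_eq h2 (convex_halfSpace_re_gt 0).isPreconnected
    (z₀ := 1) (by simp) ?_ hr
  have ht : Tendsto (fun x : ℝ => (x : ℂ)) (𝓝[>] 1) (𝓝[≠] 1) := by
    refine tendsto_nhdsWithin_iff.2 ⟨?_, ?_⟩
    · simpa using (continuous_ofReal.tendsto 1).mono_left (nhdsWithin_le_nhds (s := Set.Ioi 1))
    · filter_upwards [self_mem_nhdsWithin] with x hx
      have : x ≠ 1 := (ne_of_gt hx)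
      simpa using this
  refine ht.frequently (Eventually.frequently ?_)
  filter_upwards [self_mem_nhdsWithin] with x hx
  have hx0 : 0 < x := lt_trans one_pos hx
  have h := Real.integral_rpow_mul_exp_neg_mul_Ioi hs hx0
  have h' := congrArg (fun y : ℝ => (y : ℂ)) h
  simp only [← integral_complex_ofReal] at h'
  push_cast at h' ⊢
  rw [h', mul_comm, cpow_neg, ← ofReal_cpow hx0.le, ← ofReal_inv, ← Real.inv_rpow hx0.le, one_div]

/-! ### Fourier transforms of functions with integrable derivatives -/

/-- The complexification of a real function on the line. -/
def toC (f : ℝ → ℝ) : ℝ → ℂ := fun x => (f x : ℂ)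

theorem integrable_toC {f : ℝ → ℝ} (hf : Integrable f) : Integrable (toC f) := hf.ofReal

/-- The frequency variable `2πiξ`. -/
def freq (ξ : ℝ) : ℂ := ((2 * π * ξ : ℝ) : ℂ) * I

theorem freq_re (ξ : ℝ) : (freq ξ).re = 0 := by simp [freq]

theorem freq_im (ξ : ℝ) : (freq ξ).im = 2 * π * ξ := by simp [freq]

theorem norm_freq (ξ : ℝ) : ‖freq ξ‖ = 2 * π * |ξ| := by
  rw [freq, norm_mul, norm_I, mul_one, norm_real, Real.norm_eq_abs, abs_mul,
    abs_of_pos (by positivity)]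

theorem freq_ne_zero {ξ : ℝ} (h : ξ ≠ 0) : freq ξ ≠ 0 := by
  rw [← norm_ne_zero_iff, norm_freq]
  have := abs_pos.2 h
  positivity

theorem continuous_freq : Continuous freq := by unfold freq; fun_prop

theorem freq_mul (h ξ : ℝ) : freq (h * ξ) = h * freq ξ := by
  simp only [freq]; push_cast; ring

theorem norm_exp_freq (x ξ : ℝ) : ‖cexp (freq ξ * x)‖ = 1 := by
  rw [norm_exp]; simp [freq]

theorem continuous_fourier {f : ℝ → ℂ} (hf : Integrable f) : Continuous (𝓕 f) :=
  VectorFourier.fourierIntegral_continuous Real.continuous_fourierChar (by fun_prop) hf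

theorem fourierInv_eq_integral (g : ℝ → ℂ) (x : ℝ) :
    𝓕⁻ g x = ∫ ξ, cexp (freq ξ * x) * g ξ := by
  rw [Real.fourierInv_eq']
  refine integral_congr_ae (Eventually.of_forall fun ξ => ?_)
  simp only [freq, smul_eq_mul]
  congr 2
  simp
  ring

theorem norm_fourier_le (f : ℝ → ℂ) (ξ : ℝ) : ‖𝓕 f ξ‖ ≤ ∫ x, ‖f x‖ :=
  VectorFourier.norm_fourierIntegral_le_integral_norm _ _ _ _ _

theorem deriv_toC {f : ℝ → ℝ} (hf : Differentiable ℝ f) : deriv (toC f) = toC (deriv f) := by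
  ext x
  exact (hf x).hasDerivAt.ofReal_comp.deriv

theorem fourier_iteratedDeriv_toC {u : ℝ → ℝ} {M : ℕ} (hu : ContDiff ℝ (M : WithTop ℕ∞) u)
    (hi : ∀ k ≤ M, Integrable (iteratedDeriv k u)) {k : ℕ} (hk : k ≤ M) (ξ : ℝ) :
    𝓕 (toC (iteratedDeriv k u)) ξ = freq ξ ^ k * 𝓕 (toC u) ξ := by
  induction k with
  | zero => simp
  | succ k ih =>
    have hd : Differentiable ℝ (iteratedDeriv k u) :=
      hu.differentiable_iteratedDeriv k (by exact_mod_cast hk)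
    have hd' : Differentiable ℝ (toC (iteratedDeriv k u)) := fun x =>
      (hd x).hasDerivAt.ofReal_comp.differentiableAt
    have hi' := hi (k + 1) hk
    rw [iteratedDeriv_succ] at hi' ⊢
    rw [← deriv_toC hd, Real.fourier_deriv (integrable_toC (hi k (by omega))) hd'
      (by rw [deriv_toC hd]; exact integrable_toC hi')]
    simp only [smul_eq_mul]
    rw [ih (by omega), pow_succ, freq]
    push_cast
    ring

/-- The transform of a function with an integrable weak derivative decays like `1 / |ξ|`. -/
theorem norm_fourier_mul_le_of_primitive {G g : ℝ → ℝ} (hG : Integrable G) (hg : Integrable g)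
    (h : ∀ a b : ℝ, G b - G a = ∫ x in a..b, g x) (ξ : ℝ) :
    ‖𝓕 (toC G) ξ‖ * |ξ| ≤ ∫ x, |g x| := by
  by_cases hξ : ξ = 0
  · simp only [hξ, abs_zero, mul_zero]
    positivity
  -- A strongly measurable representative makes (s, v) ↦ g'(v + s) jointly measurable for Fubini.
  obtain ⟨g', hg'm, hgg'⟩ := hg.1
  have hg' : Integrable g' := hg.congr hgg'
  have h' : ∀ a b : ℝ, G b - G a = ∫ x in a..b, g' x := fun a b => by
    rw [h a b]
    exact intervalIntegral.integral_congr_ae (hgg'.mono fun x hx _ => hx)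
  have hint : ∫ x, |g x| = ∫ x, |g' x| :=
    integral_congr_ae (hgg'.mono fun x hx => by simp only [hx])
  -- Translation by this half period flips the sign of the character, so the transform of G is half
  -- that of G - G(· + a), whose L¹ norm is at most |a| ∫ |g|.
  set a : ℝ := (1 / (2 * ‖ξ‖ ^ 2)) • ξ with ha
  have hanorm : |a| * |ξ| = 1 / 2 := by
    rw [ha, smul_eq_mul, abs_mul, Real.norm_eq_abs, abs_of_nonneg (by positivity)]
    have : |ξ| ≠ 0 := by simpa using hξ
    field_simp
  have hprod : Integrable (fun p : ℝ × ℝ => g' (p.2 + p.1))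
      ((volume.restrict (Set.uIoc 0 a)).prod volume) := by
    have hm : StronglyMeasurable fun p : ℝ × ℝ => g' (p.2 + p.1) :=
      hg'm.comp_measurable (by fun_prop)
    rw [integrable_prod_iff hm.aestronglyMeasurable]
    refine ⟨Eventually.of_forall fun s => hg'.comp_add_right s, ?_⟩
    simp only [integral_add_right_eq_self (fun x => ‖g' x‖)]
    exact integrable_const_iff.2 (Or.inr (by
      rw [isFiniteMeasure_restrict]; simp [Set.uIoc]))
  have hpt : ∀ v, ‖toC G v - toC G (v + a)‖ ≤ ∫ s in Set.uIoc 0 a, |g' (v + s)| := by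
    intro v
    rw [toC, toC, ← ofReal_sub, norm_real, norm_sub_rev, h']
    have : ∫ x in v..v + a, g' x = ∫ s in (0 : ℝ)..a, g' (v + s) := by
      rw [intervalIntegral.integral_comp_add_left]; simp
    rw [this, intervalIntegral.norm_intervalIntegral_eq]
    exact norm_integral_le_integral_norm _
  have hbound : ∫ v, ‖toC G v - toC G (v + a)‖ ≤ |a| * ∫ x, |g x| := by
    calc ∫ v, ‖toC G v - toC G (v + a)‖
        ≤ ∫ v, ∫ s in Set.uIoc 0 a, |g' (v + s)| := by
          refine integral_mono_of_nonneg (Eventually.of_forall fun _ => norm_nonneg _)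
            hprod.norm.integral_prod_right (Eventually.of_forall hpt)
      _ = ∫ s in Set.uIoc 0 a, ∫ v, |g' (v + s)| := (integral_integral_swap hprod.norm).symm
      _ = |a| * ∫ x, |g x| := by
          simp only [integral_add_right_eq_self (fun x => |g' x|), hint]
          rw [setIntegral_const, smul_eq_mul, Measure.real, Real.volume_uIoc, sub_zero,
            ENNReal.toReal_ofReal (abs_nonneg _)]
  have key : 𝓕 (toC G) ξ = _ :=
    fourierIntegral_eq_half_sub_half_period_translate hξ (integrable_toC hG)
  have hle : ‖𝓕 (toC G) ξ‖ ≤ |a| * ∫ x, |g x| := by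
    rw [key, norm_smul]
    refine (mul_le_of_le_one_left (norm_nonneg _) (by norm_num)).trans ?_
    refine (norm_integral_le_integral_norm _).trans ?_
    simpa only [Circle.norm_smul] using hbound
  have hI : 0 ≤ ∫ x, |g x| := by positivity
  calc ‖𝓕 (toC G) ξ‖ * |ξ| ≤ (|a| * ∫ x, |g x|) * |ξ| := by gcongr
    _ = (|a| * |ξ|) * ∫ x, |g x| := by ring
    _ ≤ _ := by rw [hanorm]; linarith

theorem exists_fourier_decay {u : ℝ → ℝ} {M : ℕ} (hu : ContDiff ℝ (M : WithTop ℕ∞) u)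
    (hD : DerivsInL1 M u) :
    ∃ C : ℝ, ∀ ξ : ℝ, ‖𝓕 (toC u) ξ‖ ≤ C * (1 + |ξ|) ^ (-((M : ℝ) + 1)) := by
  obtain ⟨hi, g, hg, hG⟩ := hD
  set K₀ := ∫ x, ‖toC u x‖
  set K₁ := ∫ x, |g x|
  refine ⟨2 ^ M * (K₀ + K₁), fun ξ => ?_⟩
  have h0 : ‖𝓕 (toC u) ξ‖ ≤ K₀ := norm_fourier_le _ _
  have h1 : ‖𝓕 (toC u) ξ‖ * |ξ| ^ (M + 1) ≤ K₁ := by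
    have := norm_fourier_mul_le_of_primitive (hi M le_rfl) hg hG ξ
    rw [fourier_iteratedDeriv_toC hu hi le_rfl, norm_mul, norm_pow, norm_freq] at this
    refine le_trans ?_ this
    have h2 : |ξ| ^ M ≤ (2 * π * |ξ|) ^ M := by
      gcongr
      have := Real.pi_gt_three
      nlinarith [abs_nonneg ξ]
    calc ‖𝓕 (toC u) ξ‖ * |ξ| ^ (M + 1) = |ξ| ^ M * ‖𝓕 (toC u) ξ‖ * |ξ| := by ring
      _ ≤ _ := by gcongr
  have h3 : (1 + |ξ|) ^ (M + 1) ≤ 2 ^ M * (1 ^ (M + 1) + |ξ| ^ (M + 1)) :=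
    add_pow_le zero_le_one (abs_nonneg _) (M + 1)
  rw [Real.rpow_neg (by positivity), ← div_eq_mul_inv, le_div_iff₀ (by positivity),
    ← Nat.cast_succ, Real.rpow_natCast]
  calc ‖𝓕 (toC u) ξ‖ * (1 + |ξ|) ^ (M + 1)
      ≤ ‖𝓕 (toC u) ξ‖ * (2 ^ M * (1 ^ (M + 1) + |ξ| ^ (M + 1))) := by gcongr
    _ = 2 ^ M * (‖𝓕 (toC u) ξ‖ + ‖𝓕 (toC u) ξ‖ * |ξ| ^ (M + 1)) := by ring
    _ ≤ _ := by gcongr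

theorem integrable_rpow_mul_fourier {u : ℝ → ℝ} {M : ℕ} (hu : ContDiff ℝ (M : WithTop ℕ∞) u)
    (hD : DerivsInL1 M u) {s : ℝ} (hs0 : 0 ≤ s) (hs : s < M) :
    Integrable fun ξ : ℝ => ‖freq ξ‖ ^ s * ‖𝓕 (toC u) ξ‖ := by
  obtain ⟨C, hC⟩ := exists_fourier_decay hu hD
  have hcont : Continuous (𝓕 (toC u)) := by
    have := hD.1 0 (Nat.zero_le _)
    rw [iteratedDeriv_zero] at this
    exact continuous_fourier (integrable_toC this)
  have hint : Integrable fun ξ : ℝ => (1 + ‖ξ‖) ^ (-((M : ℝ) + 1 - s)) :=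
    integrable_one_add_norm (by simp; linarith)
  refine (hint.const_mul ((2 * π) ^ s * C)).mono' ?_ (Eventually.of_forall fun ξ => ?_)
  · exact ((continuous_freq.norm.rpow_const fun _ => Or.inr hs0).mul
      hcont.norm).aestronglyMeasurable
  · rw [Real.norm_of_nonneg (by positivity), norm_freq, Real.mul_rpow (by positivity) (abs_nonneg _),
      Real.norm_eq_abs]
    have h1 : |ξ| ^ s ≤ (1 + |ξ|) ^ s := by gcongr; linarith
    calc (2 * π) ^ s * |ξ| ^ s * ‖𝓕 (toC u) ξ‖
        ≤ (2 * π) ^ s * (1 + |ξ|) ^ s * (C * (1 + |ξ|) ^ (-((M : ℝ) + 1))) := by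
          gcongr
          exact hC ξ
      _ = (2 * π) ^ s * C * ((1 + |ξ|) ^ s * (1 + |ξ|) ^ (-((M : ℝ) + 1))) := by ring
      _ = _ := by
          rw [← Real.rpow_add (by positivity)]
          congr 2
          ring

end FracDiff

end

/-! ### The Liouville integral: convergence, differentiation and Fourier representation. -/

noncomputable section

namespace FracDiff

open Filter Topology FourierTransform Complex
open scoped Nat Real

/-- The unnormalised Liouville integral `∫_0^∞ t ^ (σ - 1) f (x - t) dt`. -/
def liouville (σ : ℝ) (f : ℝ → ℝ) (x : ℝ) : ℝ :=
  ∫ t in Set.Ioi 0, t ^ (σ - 1) * f (x - t)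

/-- A continuous, bounded, integrable function. -/
structure BddL1 (f : ℝ → ℝ) : Prop where
  continuous : Continuous f
  integrable : Integrable f
  bounded : ∃ B, ∀ x, |f x| ≤ B

theorem integrableOn_rpow_Ioc {σ : ℝ} (hσ : 0 < σ) :
    IntegrableOn (fun t : ℝ => t ^ (σ - 1)) (Set.Ioc 0 1) :=
  (intervalIntegrable_iff_integrableOn_Ioc_of_le zero_le_one).1
    (intervalIntegral.intervalIntegrable_rpow' (by linarith))

/-- For t ≤ 1 the function is bounded and the kernel carries the singularity; for t > 1 the kernel
is at most 1 and the function is integrable. -/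
theorem liouville_dominated {σ : ℝ} (hσ1 : σ ≤ 1) {f : ℝ → ℝ} {B : ℝ} (hB : ∀ x, |f x| ≤ B)
    (x : ℝ) {t : ℝ} (ht : 0 < t) :
    ‖t ^ (σ - 1) * f (x - t)‖ ≤
      (Set.Ioc 0 1).indicator (fun t : ℝ => B * t ^ (σ - 1)) t + ‖f (x - t)‖ := by
  rw [norm_mul, Real.norm_of_nonneg (by positivity : 0 ≤ t ^ (σ - 1)), Real.norm_eq_abs]
  by_cases h : t ≤ 1
  · rw [Set.indicator_of_mem (show t ∈ Set.Ioc 0 1 from ⟨ht, h⟩), mul_comm]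
    have := mul_le_mul_of_nonneg_right (hB (x - t)) (by positivity : 0 ≤ t ^ (σ - 1))
    linarith [abs_nonneg (f (x - t))]
  · rw [Set.indicator_of_notMem (fun hh => h hh.2), zero_add]
    exact mul_le_of_le_one_left (abs_nonneg _)
      (Real.rpow_le_one_of_one_le_of_nonpos (not_le.1 h).le (by linarith))

theorem integrable_indicator_rpow {σ : ℝ} (hσ : 0 < σ) (B : ℝ) :
    Integrable ((Set.Ioc 0 1).indicator fun t : ℝ => B * t ^ (σ - 1)) :=
  (integrable_indicator_iff measurableSet_Ioc).2 ((integrableOn_rpow_Ioc hσ).const_mul B)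

theorem integrable_liouville_dominant {σ : ℝ} (hσ : 0 < σ) {f : ℝ → ℝ} (hf : Integrable f)
    (B x : ℝ) : Integrable fun t =>
      (Set.Ioc 0 1).indicator (fun t : ℝ => B * t ^ (σ - 1)) t + ‖f (x - t)‖ :=
  (integrable_indicator_rpow hσ B).add
    (hf.comp_sub_left x).norm

theorem measurable_liouville_integrand (σ : ℝ) {f : ℝ → ℝ} (hf : Continuous f) :
    Measurable fun p : ℝ × ℝ => p.2 ^ (σ - 1) * f (p.1 - p.2) := by
  have := hf.measurable
  fun_prop

theorem BddL1.integrableOn {σ : ℝ} (hσ : 0 < σ) (hσ1 : σ ≤ 1) {f : ℝ → ℝ} (hf : BddL1 f) (x : ℝ) :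
    IntegrableOn (fun t => t ^ (σ - 1) * f (x - t)) (Set.Ioi 0) := by
  obtain ⟨B, hB⟩ := hf.bounded
  refine (integrable_liouville_dominant hσ hf.integrable B x).integrableOn.mono' ?_ ?_
  · exact ((measurable_liouville_integrand σ hf.continuous).comp
      (measurable_const.prodMk measurable_id)).aestronglyMeasurable
  · filter_upwards [ae_restrict_mem measurableSet_Ioi] with t ht
    exact liouville_dominated hσ1 hB x ht

theorem BddL1.exists_integral_norm_le {σ : ℝ} (hσ : 0 < σ) (hσ1 : σ ≤ 1) {f : ℝ → ℝ}
    (hf : BddL1 f) : ∃ D, ∀ x, ∫ t in Set.Ioi 0, ‖t ^ (σ - 1) * f (x - t)‖ ≤ D := by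
  obtain ⟨B, hB⟩ := hf.bounded
  refine ⟨(∫ t, (Set.Ioc 0 1).indicator (fun t : ℝ => B * t ^ (σ - 1)) t) + ∫ t, ‖f t‖,
    fun x => ?_⟩
  have hd := integrable_liouville_dominant hσ hf.integrable B x
  have hnn : ∀ t, 0 ≤ (Set.Ioc 0 1).indicator (fun t : ℝ => B * t ^ (σ - 1)) t + ‖f (x - t)‖ := by
    intro t
    have hB0 : 0 ≤ B := (abs_nonneg _).trans (hB 0)
    refine add_nonneg (Set.indicator_nonneg (fun t ht => ?_) _) (norm_nonneg _)
    have := ht.1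
    positivity
  calc ∫ t in Set.Ioi 0, ‖t ^ (σ - 1) * f (x - t)‖
      ≤ ∫ t in Set.Ioi 0, (Set.Ioc 0 1).indicator (fun t : ℝ => B * t ^ (σ - 1)) t +
          ‖f (x - t)‖ :=
        setIntegral_mono_on (hf.integrableOn hσ hσ1 x).norm hd.integrableOn measurableSet_Ioi
          fun t ht => liouville_dominated hσ1 hB x ht
    _ ≤ ∫ t, (Set.Ioc 0 1).indicator (fun t : ℝ => B * t ^ (σ - 1)) t + ‖f (x - t)‖ :=
        setIntegral_le_integral hd (Eventually.of_forall hnn)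
    _ = _ := by
        rw [integral_add (integrable_indicator_rpow hσ B) (hf.integrable.comp_sub_left x).norm,
          integral_sub_left_eq_self (fun t => ‖f t‖)]

/-- Fubini turns the integral of `liouville σ f'` over [0, b] into an increment of `liouville σ f`;
the assumed continuity then allows the fundamental theorem of calculus. -/
theorem hasDerivAt_liouville {σ : ℝ} (hσ : 0 < σ) (hσ1 : σ ≤ 1) {f f' : ℝ → ℝ}
    (hf : BddL1 f) (hf' : BddL1 f') (hd : ∀ x, HasDerivAt f (f' x) x)
    (hc : Continuous (liouville σ f')) (x : ℝ) :
    HasDerivAt (liouville σ f) (liouville σ f' x) x := by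
  obtain ⟨D, hD⟩ := hf'.exists_integral_norm_le hσ hσ1
  have hprod : ∀ b : ℝ, Integrable (Function.uncurry fun y t : ℝ => t ^ (σ - 1) * f' (y - t))
      ((volume.restrict (Set.uIoc 0 b)).prod (volume.restrict (Set.Ioi 0))) := by
    intro b
    have hm := (measurable_liouville_integrand σ hf'.continuous).aestronglyMeasurable
      (μ := (volume.restrict (Set.uIoc 0 b)).prod (volume.restrict (Set.Ioi 0)))
    refine (integrable_prod_iff hm).2 ⟨Eventually.of_forall fun y => hf'.integrableOn hσ hσ1 y, ?_⟩
    have hfin : IsFiniteMeasure (volume.restrict (Set.uIoc 0 b)) := by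
      rw [isFiniteMeasure_restrict]; simp [Set.uIoc]
    refine Integrable.of_bound hm.norm.integral_prod_right' D (Eventually.of_forall fun y => ?_)
    rw [Real.norm_of_nonneg (integral_nonneg fun _ => norm_nonneg _)]
    exact hD y
  have heq : ∀ b, liouville σ f b = liouville σ f 0 + ∫ y in (0 : ℝ)..b, liouville σ f' y := by
    intro b
    have h1 : ∫ y in (0 : ℝ)..b, liouville σ f' y =
        ∫ t in Set.Ioi 0, ∫ y in (0 : ℝ)..b, t ^ (σ - 1) * f' (y - t) :=
      intervalIntegral_integral_swap (hprod b)
    have h2 : ∀ t, ∫ y in (0 : ℝ)..b, t ^ (σ - 1) * f' (y - t) =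
        t ^ (σ - 1) * f (b - t) - t ^ (σ - 1) * f (0 - t) := by
      intro t
      rw [intervalIntegral.integral_const_mul, ← mul_sub]
      congr 1
      refine intervalIntegral.integral_eq_sub_of_hasDerivAt (f := fun y => f (y - t))
        (fun y _ => (hd (y - t)).comp_sub_const y t) ?_
      exact (hf'.continuous.comp (by fun_prop)).intervalIntegrable _ _
    rw [h1]
    simp only [h2]
    rw [integral_sub (hf.integrableOn hσ hσ1 b) (hf.integrableOn hσ hσ1 0), liouville, liouville]
    ring
  have h := (intervalIntegral.integral_hasDerivAt_right (hc.intervalIntegrable 0 x)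
    (hc.stronglyMeasurableAtFilter _ _) hc.continuousAt).const_add (liouville σ f 0)
  exact h.congr_of_eventuallyEq (Eventually.of_forall heq)

/-- The Fourier representation of the Liouville integral. -/
theorem liouville_eq_fourier {σ : ℝ} (hσ : 0 < σ) (hσ1 : σ ≤ 1) {f : ℝ → ℝ} (hf : BddL1 f)
    (hF : Integrable (𝓕 (toC f)))
    (hF' : Integrable fun ξ => ‖freq ξ‖ ^ (-σ) * ‖𝓕 (toC f) ξ‖) (x : ℝ) :
    (liouville σ f x : ℂ) = Real.Gamma σ *
      ∫ ξ, cexp (freq ξ * x) * (freq ξ ^ (-(σ : ℂ)) * 𝓕 (toC f) ξ) := by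
  have hcont : Continuous (toC f) := continuous_ofReal.comp hf.continuous
  have hinv : ∀ y, (f y : ℂ) = ∫ ξ, cexp (freq ξ * y) * 𝓕 (toC f) ξ := by
    intro y
    rw [← fourierInv_eq_integral, hcont.fourierInv_fourier_eq (integrable_toC hf.integrable) hF]
    rfl
  have hint := hf.integrableOn hσ hσ1 x
  -- The kernel is not integrable at infinity; the factor e^{-εt} restores the absolute convergence
  -- that Fubini needs.
  have t1 : Tendsto (fun ε : ℝ => ∫ t in Set.Ioi (0 : ℝ),
      cexp (-(ε * t)) * ((t ^ (σ - 1) * f (x - t) : ℝ) : ℂ)) (𝓝[>] 0) (𝓝 (liouville σ f x : ℂ)) := by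
    have e : (liouville σ f x : ℂ) = ∫ t in Set.Ioi (0 : ℝ), ((t ^ (σ - 1) * f (x - t) : ℝ) : ℂ) := by
      rw [integral_complex_ofReal]; rfl
    rw [e]
    refine tendsto_integral_filter_of_dominated_convergence
      (fun t => ‖t ^ (σ - 1) * f (x - t)‖) ?_ ?_ hint.norm ?_
    · refine Eventually.of_forall fun ε => ?_
      exact (Continuous.aestronglyMeasurable (by fun_prop)).mul hint.ofReal.1
    · filter_upwards [self_mem_nhdsWithin] with ε hε
      filter_upwards [ae_restrict_mem measurableSet_Ioi] with t ht
      have hε' : 0 < ε := hε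
      have ht' : 0 < t := ht
      rw [norm_mul, norm_real]
      refine mul_le_of_le_one_left (norm_nonneg _) ?_
      rw [norm_exp]
      simp
      positivity
    · refine Eventually.of_forall fun t => ?_
      have : Continuous fun ε : ℝ => cexp (-(ε * t)) * ((t ^ (σ - 1) * f (x - t) : ℝ) : ℂ) := by
        fun_prop
      simpa using (this.tendsto 0).mono_left (nhdsWithin_le_nhds (s := Set.Ioi 0))
  have hswap : ∀ ε : ℝ, 0 < ε → ∫ t in Set.Ioi (0 : ℝ),
      cexp (-(ε * t)) * ((t ^ (σ - 1) * f (x - t) : ℝ) : ℂ) =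
      Real.Gamma σ * ∫ ξ, cexp (freq ξ * x) * ((ε + freq ξ) ^ (-(σ : ℂ)) * 𝓕 (toC f) ξ) := by
    intro ε hε
    have hr : ∀ ξ, 0 < ((ε : ℂ) + freq ξ).re := fun ξ => by simpa [freq_re] using hε
    have hprod : Integrable (Function.uncurry fun (t ξ : ℝ) =>
        cexp (freq ξ * (x - t)) * ((((t ^ (σ - 1) : ℝ) : ℂ) * cexp (-(ε * t))) * 𝓕 (toC f) ξ))
        ((volume.restrict (Set.Ioi (0 : ℝ))).prod volume) := by
      have h := (integrableOn_rpow_mul_cexp hσ (r := (ε : ℂ)) (by simpa using hε)).mul_prod hF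
      refine h.bdd_mul (c := 1) ?_ (Eventually.of_forall fun p => ?_)
      · refine Continuous.aestronglyMeasurable ?_
        have := continuous_freq
        fun_prop
      · have := norm_exp_freq (x - p.1) p.2
        push_cast at this
        exact this.le
    have hstep : ∀ ξ, ∫ t in Set.Ioi (0 : ℝ), cexp (freq ξ * (x - t)) *
        ((((t ^ (σ - 1) : ℝ) : ℂ) * cexp (-(ε * t))) * 𝓕 (toC f) ξ) =
        Real.Gamma σ * (cexp (freq ξ * x) * ((ε + freq ξ) ^ (-(σ : ℂ)) * 𝓕 (toC f) ξ)) := by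
      intro ξ
      have : ∀ t : ℝ, cexp (freq ξ * (x - t)) *
          ((((t ^ (σ - 1) : ℝ) : ℂ) * cexp (-(ε * t))) * 𝓕 (toC f) ξ) =
          (((t ^ (σ - 1) : ℝ) : ℂ) * cexp (-((ε + freq ξ) * t))) *
            (cexp (freq ξ * x) * 𝓕 (toC f) ξ) := by
        intro t
        rw [show freq ξ * (x - t) = freq ξ * x + -(freq ξ * t) by ring,
          show -(((ε : ℂ) + freq ξ) * t) = -(ε * t) + -(freq ξ * t) by ring, Complex.exp_add,
          Complex.exp_add]
        ring
      simp only [this]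
      rw [integral_mul_const, integral_rpow_mul_cexp hσ (hr ξ)]
      ring
    calc ∫ t in Set.Ioi (0 : ℝ), cexp (-(ε * t)) * ((t ^ (σ - 1) * f (x - t) : ℝ) : ℂ)
        = ∫ t in Set.Ioi (0 : ℝ), ∫ ξ, cexp (freq ξ * (x - t)) *
            ((((t ^ (σ - 1) : ℝ) : ℂ) * cexp (-(ε * t))) * 𝓕 (toC f) ξ) := by
          refine integral_congr_ae (Eventually.of_forall fun t => ?_)
          simp only [mul_left_comm (cexp (freq _ * _))]
          rw [integral_const_mul]
          have := hinv (x - t)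
          push_cast at this ⊢
          rw [this]
          ring
      _ = ∫ ξ, ∫ t in Set.Ioi (0 : ℝ), cexp (freq ξ * (x - t)) *
            ((((t ^ (σ - 1) : ℝ) : ℂ) * cexp (-(ε * t))) * 𝓕 (toC f) ξ) :=
          integral_integral_swap hprod
      _ = _ := by
          simp only [hstep]
          rw [integral_const_mul]
  have hne : ∀ᵐ ξ : ℝ, ξ ≠ 0 := by
    simp [ae_iff]
  have hFc : Continuous (𝓕 (toC f)) := continuous_fourier (integrable_toC hf.integrable)
  have t2 : Tendsto (fun ε : ℝ => ∫ ξ, cexp (freq ξ * x) *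
      ((ε + freq ξ) ^ (-(σ : ℂ)) * 𝓕 (toC f) ξ)) (𝓝[>] 0)
      (𝓝 (∫ ξ, cexp (freq ξ * x) * (freq ξ ^ (-(σ : ℂ)) * 𝓕 (toC f) ξ))) := by
    refine tendsto_integral_filter_of_dominated_convergence _ ?_ ?_ hF' ?_
    · refine Eventually.of_forall fun ε => Measurable.aestronglyMeasurable ?_
      have := continuous_freq.measurable
      have := hFc.measurable
      fun_prop
    · filter_upwards [self_mem_nhdsWithin] with ε hε
      have hε' : 0 < ε := hε
      filter_upwards [hne] with ξ hξ
      have hn : 0 < ‖freq ξ‖ := norm_pos_iff.2 (freq_ne_zero hξ)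
      rw [norm_mul, norm_exp_freq, one_mul, norm_mul]
      gcongr
      rw [← ofReal_neg, norm_cpow_real]
      -- Adding ε > 0 to a purely imaginary number does not decrease its modulus, so the negative
      -- power is dominated by its value at ε = 0.
      refine Real.rpow_le_rpow_of_nonpos hn ?_ (by linarith)
      have h1 : ‖freq ξ‖ = |(freq ξ).im| := by
        rw [norm_freq, freq_im, abs_mul, abs_of_pos (by positivity : 0 < 2 * π)]
      rw [h1]
      have := abs_im_le_norm ((ε : ℂ) + freq ξ)
      simpa using this
    · filter_upwards [hne] with ξ hξ
      have hs : freq ξ ∈ slitPlane := by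
        refine Or.inr ?_
        rw [freq_im]
        positivity
      have hc : ContinuousAt (fun ε : ℝ => ((ε : ℂ) + freq ξ) ^ (-(σ : ℂ))) 0 := by
        refine ContinuousAt.cpow (by fun_prop) continuousAt_const ?_
        simpa using hs
      have := (hc.tendsto.mono_left (nhdsWithin_le_nhds (s := Set.Ioi 0)))
      simp only [ofReal_zero, zero_add] at this
      exact (this.mul_const _).const_mul _
  refine tendsto_nhds_unique t1 ((t2.const_mul _).congr' ?_)
  filter_upwards [self_mem_nhdsWithin] with ε hε using (hswap ε hε).symm

end FracDiff

end

/-! ### Riemann-Liouville derivatives as Fourier multipliers. -/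

noncomputable section

namespace FracDiff

open Filter Topology FourierTransform Complex
open scoped Nat Real

theorem continuous_integral_exp_freq {g : ℝ → ℂ} (hg : Integrable g) :
    Continuous fun x : ℝ => ∫ ξ, cexp (freq ξ * x) * g ξ := by
  refine continuous_of_dominated (fun x => ?_) (fun x => Eventually.of_forall fun ξ => ?_) hg.norm
    (Eventually.of_forall fun ξ => by fun_prop)
  · have := continuous_freq
    exact (Continuous.aestronglyMeasurable (by fun_prop)).mul hg.1
  · rw [norm_mul, norm_exp_freq, one_mul]

theorem norm_integral_exp_freq_le (g : ℝ → ℂ) (x : ℝ) :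
    ‖∫ ξ, cexp (freq ξ * x) * g ξ‖ ≤ ∫ ξ, ‖g ξ‖ := by
  refine (norm_integral_le_integral_norm _).trans_eq ?_
  simp only [norm_mul, norm_exp_freq, one_mul]

section

variable {u : ℝ → ℝ} {M : ℕ}

theorem integrable_of_derivsInL1 (hD : DerivsInL1 M u) : Integrable u := by
  have := hD.1 0 (Nat.zero_le _)
  rwa [iteratedDeriv_zero] at this

theorem continuous_fourier_toC (hD : DerivsInL1 M u) : Continuous (𝓕 (toC u)) :=
  continuous_fourier (integrable_toC (integrable_of_derivsInL1 hD))

theorem integrable_cpow_mul_fourier (hu : ContDiff ℝ (M : WithTop ℕ∞) u) (hD : DerivsInL1 M u)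
    {s : ℝ} (hs0 : 0 ≤ s) (hs : s < M) :
    Integrable fun ξ => freq ξ ^ (s : ℂ) * 𝓕 (toC u) ξ := by
  refine (integrable_rpow_mul_fourier hu hD hs0 hs).mono' ?_ (Eventually.of_forall fun ξ => ?_)
  · have := continuous_freq.measurable
    have := (continuous_fourier_toC hD).measurable
    exact Measurable.aestronglyMeasurable (by fun_prop)
  · rw [norm_mul, norm_cpow_real]

theorem integrable_fourier_iteratedDeriv (hu : ContDiff ℝ (M : WithTop ℕ∞) u)
    (hD : DerivsInL1 M u) {k : ℕ} (hk : k < M) :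
    Integrable (𝓕 (toC (iteratedDeriv k u))) := by
  have h := integrable_cpow_mul_fourier hu hD (s := k) (by positivity) (by exact_mod_cast hk)
  refine h.congr (Eventually.of_forall fun ξ => ?_)
  simp only
  rw [fourier_iteratedDeriv_toC hu hD.1 hk.le, ofReal_natCast, cpow_natCast]

theorem iteratedDeriv_eq_integral (hu : ContDiff ℝ (M : WithTop ℕ∞) u)
    (hD : DerivsInL1 M u) {k : ℕ} (hk : k < M) (x : ℝ) :
    ((iteratedDeriv k u x : ℝ) : ℂ) =
      ∫ ξ, cexp (freq ξ * x) * 𝓕 (toC (iteratedDeriv k u)) ξ := by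
  have hc : Continuous (toC (iteratedDeriv k u)) :=
    continuous_ofReal.comp (hu.continuous_iteratedDeriv k (by exact_mod_cast hk.le))
  rw [← fourierInv_eq_integral, hc.fourierInv_fourier_eq (integrable_toC (hD.1 k hk.le))
    (integrable_fourier_iteratedDeriv hu hD hk)]
  rfl

theorem bddL1_iteratedDeriv (hu : ContDiff ℝ (M : WithTop ℕ∞) u)
    (hD : DerivsInL1 M u) {k : ℕ} (hk : k < M) : BddL1 (iteratedDeriv k u) := by
  refine ⟨hu.continuous_iteratedDeriv k (by exact_mod_cast hk.le), hD.1 k hk.le,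
    ∫ ξ, ‖𝓕 (toC (iteratedDeriv k u)) ξ‖, fun x => ?_⟩
  rw [← Real.norm_eq_abs, ← norm_real, iteratedDeriv_eq_integral hu hD hk]
  exact norm_integral_exp_freq_le _ _

theorem ae_ne_zero : ∀ᵐ ξ : ℝ, ξ ≠ 0 := by simp [ae_iff]

/-- At least one derivative makes the exponent k - σ nonnegative, removing the singularity of the
multiplier at frequency 0. -/
theorem liouville_iteratedDeriv (hu : ContDiff ℝ (M : WithTop ℕ∞) u)
    (hD : DerivsInL1 M u) {k : ℕ} (hk0 : 1 ≤ k) (hk : k < M) {σ : ℝ} (hσ : 0 < σ) (hσ1 : σ ≤ 1)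
    (x : ℝ) :
    (liouville σ (iteratedDeriv k u) x : ℂ) = Real.Gamma σ *
      ∫ ξ, cexp (freq ξ * x) * (freq ξ ^ ((k - σ : ℝ) : ℂ) * 𝓕 (toC u) ξ) := by
  have hk1 : (1 : ℝ) ≤ k := by exact_mod_cast hk0
  have hkM : (k : ℝ) < M := by exact_mod_cast hk
  have hint : Integrable fun ξ => ‖freq ξ‖ ^ (-σ) * ‖𝓕 (toC (iteratedDeriv k u)) ξ‖ := by
    refine (integrable_rpow_mul_fourier hu hD (s := k - σ) (by linarith) (by linarith)).congr ?_
    filter_upwards [ae_ne_zero] with ξ hξ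
    rw [fourier_iteratedDeriv_toC hu hD.1 hk.le, norm_mul, norm_pow, ← mul_assoc,
      ← Real.rpow_natCast, ← Real.rpow_add (norm_pos_iff.2 (freq_ne_zero hξ))]
    ring_nf
  rw [liouville_eq_fourier hσ hσ1 (bddL1_iteratedDeriv hu hD hk)
    (integrable_fourier_iteratedDeriv hu hD hk) hint]
  congr 1
  refine integral_congr_ae ?_
  filter_upwards [ae_ne_zero] with ξ hξ
  rw [fourier_iteratedDeriv_toC hu hD.1 hk.le, ← mul_assoc (freq ξ ^ (-(σ : ℂ))), ← cpow_natCast,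
    ← cpow_add _ _ (freq_ne_zero hξ)]
  push_cast
  ring_nf

theorem continuous_liouville_iteratedDeriv (hu : ContDiff ℝ (M : WithTop ℕ∞) u)
    (hD : DerivsInL1 M u) {k : ℕ} (hk0 : 1 ≤ k) (hk : k < M) {σ : ℝ} (hσ : 0 < σ) (hσ1 : σ ≤ 1) :
    Continuous (liouville σ (iteratedDeriv k u)) := by
  have hk1 : (1 : ℝ) ≤ k := by exact_mod_cast hk0
  have hkM : (k : ℝ) < M := by exact_mod_cast hk
  have hg := integrable_cpow_mul_fourier hu hD (s := k - σ) (by linarith) (by linarith)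
  have hc := (continuous_const (y := (Real.Gamma σ : ℂ))).mul (continuous_integral_exp_freq hg)
  refine (continuous_re.comp hc).congr fun x => ?_
  exact (congrArg re (liouville_iteratedDeriv hu hD hk0 hk hσ hσ1 x)).symm

theorem hasDerivAt_liouville_iteratedDeriv (hu : ContDiff ℝ (M : WithTop ℕ∞) u)
    (hD : DerivsInL1 M u) {k : ℕ} (hk : k + 1 < M) {σ : ℝ} (hσ : 0 < σ) (hσ1 : σ ≤ 1) (x : ℝ) :
    HasDerivAt (liouville σ (iteratedDeriv k u)) (liouville σ (iteratedDeriv (k + 1) u) x) x := by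
  refine hasDerivAt_liouville hσ hσ1 (bddL1_iteratedDeriv hu hD (by omega))
    (bddL1_iteratedDeriv hu hD hk) (fun y => ?_)
    (continuous_liouville_iteratedDeriv hu hD (by omega) hk hσ hσ1) x
  rw [iteratedDeriv_succ]
  exact (hu.differentiable_iteratedDeriv k (by exact_mod_cast (by omega : k < M)) y).hasDerivAt

theorem iteratedDeriv_liouville (hu : ContDiff ℝ (M : WithTop ℕ∞) u)
    (hD : DerivsInL1 M u) {k : ℕ} (hk : k < M) {σ : ℝ} (hσ : 0 < σ) (hσ1 : σ ≤ 1) :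
    iteratedDeriv k (liouville σ u) = liouville σ (iteratedDeriv k u) := by
  induction k with
  | zero => simp
  | succ k ih =>
    rw [iteratedDeriv_succ, ih (by omega)]
    ext x
    exact (hasDerivAt_liouville_iteratedDeriv hu hD hk hσ hσ1 x).deriv

theorem contDiff_liouville (hu : ContDiff ℝ (M : WithTop ℕ∞) u)
    (hD : DerivsInL1 M u) {m : ℕ} (hm0 : 1 ≤ m) (hm : m < M) {σ : ℝ} (hσ : 0 < σ) (hσ1 : σ ≤ 1) :
    ContDiff ℝ (m : WithTop ℕ∞) (liouville σ u) := by
  have hdiff : ∀ k < m, Differentiable ℝ (iteratedDeriv k (liouville σ u)) := fun k hk x => by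
    rw [iteratedDeriv_liouville hu hD (by omega) hσ hσ1]
    exact (hasDerivAt_liouville_iteratedDeriv hu hD (by omega) hσ hσ1 x).differentiableAt
  refine contDiff_nat_iff_iteratedDeriv.2 ⟨fun k hk => ?_, fun k hk => hdiff k hk⟩
  rcases Nat.eq_zero_or_pos k with rfl | hk0
  -- Order 0 has no Fourier formula here, so continuity is deduced from differentiability.
  · exact (hdiff 0 hm0).continuous
  · rw [iteratedDeriv_liouville hu hD (by omega) hσ hσ1]
    exact continuous_liouville_iteratedDeriv hu hD hk0 (by omega) hσ hσ1

end

theorem one_le_rlOrder (β : ℝ) : 1 ≤ rlOrder β := Nat.succ_pos _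

theorem rlOrder_sub_pos (β : ℝ) : 0 < (rlOrder β : ℝ) - β := by
  have := Nat.lt_floor_add_one β
  simp only [rlOrder]
  push_cast
  linarith

theorem rlOrder_sub_le_one {β : ℝ} (hβ : 0 ≤ β) : (rlOrder β : ℝ) - β ≤ 1 := by
  have := Nat.floor_le hβ
  simp only [rlOrder]
  push_cast
  linarith

theorem rlIntegrand_eq (β : ℝ) (u : ℝ → ℝ) (x : ℝ) {t : ℝ} (ht : 0 < t) :
    rlIntegrand β u x (x - t) = t ^ ((rlOrder β : ℝ) - β - 1) * u (x - t) := by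
  rw [rlIntegrand, sub_sub_cancel, div_eq_mul_inv, ← Real.rpow_neg ht.le, mul_comm]
  ring_nf

theorem preimage_sub_left_Iio (x : ℝ) : (fun t => x - t) ⁻¹' Set.Iio x = Set.Ioi 0 := by
  ext t; simp

theorem measurableEmbedding_sub_left (x : ℝ) : MeasurableEmbedding fun t : ℝ => x - t :=
  (MeasurableEquiv.subLeft x).measurableEmbedding

theorem integrableOn_rlIntegrand_iff (β : ℝ) (u : ℝ → ℝ) (x : ℝ) :
    IntegrableOn (rlIntegrand β u x) (Set.Iic x) ↔
      IntegrableOn (fun t => t ^ ((rlOrder β : ℝ) - β - 1) * u (x - t)) (Set.Ioi 0) := by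
  rw [integrableOn_Iic_iff_integrableOn_Iio,
    ← (volume.measurePreserving_sub_left x).integrableOn_comp_preimage
      (measurableEmbedding_sub_left x), preimage_sub_left_Iio]
  exact integrableOn_congr_fun (fun t ht => rlIntegrand_eq β u x ht) measurableSet_Ioi

theorem rlPrimitive_eq_liouville (β : ℝ) (u : ℝ → ℝ) :
    rlPrimitive β u = liouville ((rlOrder β : ℝ) - β) u := by
  ext x
  rw [rlPrimitive, integral_Iic_eq_integral_Iio,
    ← (volume.measurePreserving_sub_left x).setIntegral_preimage_emb
      (measurableEmbedding_sub_left x), preimage_sub_left_Iio]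
  exact setIntegral_congr_fun measurableSet_Ioi fun t ht => rlIntegrand_eq β u x ht

theorem rlDifferentiable {u : ℝ → ℝ} {M : ℕ} (hu : ContDiff ℝ (M : WithTop ℕ∞) u)
    (hD : DerivsInL1 M u) {β : ℝ} (hβ : 0 ≤ β) (hM : rlOrder β < M) : RLDifferentiable β u := by
  have hσ := rlOrder_sub_pos β
  have hσ1 := rlOrder_sub_le_one hβ
  refine ⟨fun x => ?_, ?_⟩
  · rw [integrableOn_rlIntegrand_iff]
    have := bddL1_iteratedDeriv hu hD (k := 0) (by omega)
    rw [iteratedDeriv_zero] at this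
    exact this.integrableOn hσ hσ1 x
  · rw [rlPrimitive_eq_liouville]
    exact contDiff_liouville hu hD (one_le_rlOrder β) hM hσ hσ1

/-- With σ = m - β and m derivatives, the exponent m - σ is β and the Gamma factors cancel. -/
theorem rlDeriv_eq_integral {u : ℝ → ℝ} {M : ℕ} (hu : ContDiff ℝ (M : WithTop ℕ∞) u)
    (hD : DerivsInL1 M u) {β : ℝ} (hβ : 0 ≤ β) (hM : rlOrder β < M) (x : ℝ) :
    (rlDeriv β u x : ℂ) = ∫ ξ, cexp (freq ξ * x) * (freq ξ ^ (β : ℂ) * 𝓕 (toC u) ξ) := by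
  have hσ := rlOrder_sub_pos β
  have hσ1 := rlOrder_sub_le_one hβ
  rw [rlDeriv, rlPrimitive_eq_liouville, iteratedDeriv_liouville hu hD hM hσ hσ1, ofReal_mul,
    liouville_iteratedDeriv hu hD (one_le_rlOrder β) hM hσ hσ1, ← mul_assoc, ← ofReal_mul,
    one_div_mul_cancel (Real.Gamma_pos_of_pos hσ).ne', ofReal_one, one_mul, sub_sub_cancel]

end FracDiff

end

/-! ### The difference operator as a Fourier multiplier, and the expansion. -/

noncomputable section

namespace FracDiff

open Filter Topology FourierTransform Complex
open scoped Nat Real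

section

variable {α : ℝ} {u : ℝ → ℝ} {M : ℕ}

theorem summable_leftBTerm (h1 : 1 < α) (h2 : α ≤ 2) (hu : BddL1 u) (h x : ℝ) :
    Summable (leftBTerm α h u x) := by
  obtain ⟨B, hB⟩ := hu.bounded
  refine Summable.of_norm_bounded ((summable_kappa h1 h2).mul_right B) fun l => ?_
  rw [leftBTerm, norm_mul]
  gcongr
  exact hB _

theorem norm_exp_neg_freq (ξ : ℝ) : ‖cexp (-freq ξ)‖ = 1 := by
  rw [norm_exp]; simp [freq]

/-- A shift by (l - 1)h multiplies the transform by e^z (e^{-z})^l with z = `freq (h * ξ)`; absolute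
summability of the coefficients justifies summing under the integral. -/
theorem tsum_leftBTerm_eq_integral (h1 : 1 < α) (h2 : α ≤ 2) (hu : ContDiff ℝ (M : WithTop ℕ∞) u)
    (hD : DerivsInL1 M u) (hM : 0 < M) (h x : ℝ) :
    ((∑' l, leftBTerm α h u x l : ℝ) : ℂ) = ∫ ξ, cexp (freq ξ * x) *
      (cexp (freq (h * ξ)) * genWC α (cexp (-freq (h * ξ))) * 𝓕 (toC u) ξ) := by
  have hF := integrable_fourier_iteratedDeriv hu hD hM
  have hinv := iteratedDeriv_eq_integral hu hD hM
  rw [iteratedDeriv_zero] at hF hinv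
  set F : ℕ → ℝ → ℂ := fun l ξ =>
    (kappa α l : ℂ) * (cexp (freq ξ * (x - ((l : ℝ) - 1) * h : ℝ)) * 𝓕 (toC u) ξ) with hFdef
  have hnorm : ∀ l ξ, ‖F l ξ‖ = ‖kappa α l‖ * ‖𝓕 (toC u) ξ‖ := fun l ξ => by
    simp only [hFdef, norm_mul, norm_real, norm_exp_freq, one_mul]
  have hFint : ∀ l, Integrable (F l) := fun l => by
    refine Integrable.const_mul (hF.bdd_mul (c := 1) ?_ (Eventually.of_forall fun ξ =>
      (norm_exp_freq _ ξ).le)) _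
    have := continuous_freq
    exact Continuous.aestronglyMeasurable (by fun_prop)
  have hsum : Summable fun l => ∫ ξ, ‖F l ξ‖ := by
    simp only [hnorm, integral_const_mul]
    exact (summable_kappa h1 h2).mul_right _
  have hF1 : ∀ l, ((leftBTerm α h u x l : ℝ) : ℂ) = ∫ ξ, F l ξ := fun l => by
    rw [leftBTerm, ofReal_mul, hinv, ← integral_const_mul]
  rw [ofReal_tsum, tsum_congr hF1, integral_tsum_of_summable_integral_norm hFint hsum]
  refine integral_congr_ae (Eventually.of_forall fun ξ => ?_)
  simp only
  have hs := hasSum_kappa_mul_pow h1 h2 (norm_exp_neg_freq (h * ξ)).le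
  rw [← hs.tsum_eq, ← tsum_mul_left, ← tsum_mul_right, ← tsum_mul_left]
  refine tsum_congr fun l => ?_
  have he : cexp (freq ξ * (x - ((l : ℝ) - 1) * h : ℝ)) =
      cexp (freq ξ * x) * (cexp (freq (h * ξ)) * cexp (-freq (h * ξ)) ^ l) := by
    rw [← Complex.exp_nat_mul, ← Complex.exp_add, ← Complex.exp_add, freq_mul]
    congr 1
    push_cast
    ring
  rw [hFdef]
  simp only
  rw [he]
  ring

theorem rlOrder_add_natCast (h0 : 0 ≤ α) (l : ℕ) : rlOrder (α + l) = ⌊α⌋₊ + l + 1 := by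
  rw [rlOrder, Nat.floor_add_natCast h0]

theorem cpow_add_natCast (hα : 0 < α) (z : ℂ) (l : ℕ) :
    z ^ ((α + l : ℝ) : ℂ) = z ^ (α : ℂ) * z ^ l := by
  by_cases hz : z = 0
  · have h1 : ((α + l : ℝ) : ℂ) ≠ 0 := by
      have : 0 < α + l := by positivity
      exact_mod_cast this.ne'
    have h2 : (α : ℂ) ≠ 0 := by exact_mod_cast hα.ne'
    rw [hz, zero_cpow h1, zero_cpow h2, zero_mul]
  · rw [ofReal_add, cpow_add _ _ hz, ofReal_natCast, cpow_natCast]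

/-- The whole remainder is one Fourier integral. The symbol bound at h · `freq ξ` supplies h^{α+n},
the prefactor removes h^α, and the remaining integral is independent of h and x. -/
theorem exists_leftB_expansion_bound (h1 : 1 < α) (h2 : α ≤ 2) {γ : ℕ → ℝ}
    (hγ : HasFPowerSeriesAt (symbol α)
      (FormalMultilinearSeries.ofScalars ℂ fun l => (γ l : ℂ)) 0) {n : ℕ}
    (hu : ContDiff ℝ (M : WithTop ℕ∞) u) (hD : DerivsInL1 M u) (hM : M = ⌊α⌋₊ + n + 1) :
    ∃ C : ℝ, ∀ h : ℝ, 0 < h → ∀ x : ℝ,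
      |leftB α h u x - ∑ l ∈ Finset.range n, γ l * rlDeriv (α + l) u x * h ^ l| ≤ C * h ^ n := by
  have hα0 : 0 < α := by linarith
  obtain ⟨C, hC⟩ := exists_symbol_bound h1 h2 hγ n
  have hfloor : α < ⌊α⌋₊ + 1 := Nat.lt_floor_add_one α
  have hMr : (M : ℝ) = ⌊α⌋₊ + n + 1 := by rw [hM]; push_cast; ring
  -- This is where the smoothness order is used up: α + n < [α] + n + 1 = M.
  have hdom := integrable_rpow_mul_fourier hu hD (s := α + n) (by positivity) (by linarith)
  refine ⟨C * ∫ ξ, ‖freq ξ‖ ^ (α + n) * ‖𝓕 (toC u) ξ‖, fun h hh x => ?_⟩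
  have hl : ∀ l ∈ Finset.range n, ((rlDeriv (α + l) u x : ℝ) : ℂ) =
      ∫ ξ, cexp (freq ξ * x) * (freq ξ ^ ((α + l : ℝ) : ℂ) * 𝓕 (toC u) ξ) := fun l hl => by
    have := Finset.mem_range.1 hl
    exact rlDeriv_eq_integral hu hD (by positivity)
      (by rw [rlOrder_add_natCast hα0.le]; omega) x
  have hexp : ∀ {g : ℝ → ℂ}, Integrable g → Integrable fun ξ => cexp (freq ξ * x) * g ξ := by
    intro g hg
    refine hg.bdd_mul (c := 1) ?_ (Eventually.of_forall fun ξ => (norm_exp_freq _ ξ).le)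
    have := continuous_freq
    exact Continuous.aestronglyMeasurable (by fun_prop)
  have hli : ∀ l ∈ Finset.range n, Integrable fun ξ =>
      (γ l : ℂ) * (cexp (freq ξ * x) * (freq ξ ^ ((α + l : ℝ) : ℂ) * 𝓕 (toC u) ξ)) * (h : ℂ) ^ l := by
    intro l hl
    have hln : (l : ℝ) < n := by exact_mod_cast Finset.mem_range.1 hl
    exact ((hexp (integrable_cpow_mul_fourier hu hD (by positivity)
      (by linarith))).const_mul _).mul_const _
  have hF := integrable_fourier_iteratedDeriv hu hD (k := 0) (by omega)
  rw [iteratedDeriv_zero] at hF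
  have hSm : Measurable fun ξ => cexp (freq (h * ξ)) * genWC α (cexp (-freq (h * ξ))) := by
    have := continuous_freq.measurable
    unfold genWC
    fun_prop
  have hSi : Integrable fun ξ => cexp (freq (h * ξ)) * genWC α (cexp (-freq (h * ξ))) *
      𝓕 (toC u) ξ := by
    refine hF.bdd_mul (c := ∑' l, ‖kappa α l‖) hSm.aestronglyMeasurable
      (Eventually.of_forall fun ξ => ?_)
    rw [norm_mul, norm_exp, freq_re, Real.exp_zero, one_mul]
    exact norm_genWC_le h1 h2 (norm_exp_neg_freq _).le
  have hkey : ((leftB α h u x - ∑ l ∈ Finset.range n, γ l * rlDeriv (α + l) u x * h ^ l : ℝ) : ℂ) =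
      ∫ ξ, cexp (freq ξ * x) * (((1 / h ^ α : ℝ) : ℂ) *
        (cexp (freq (h * ξ)) * genWC α (cexp (-freq (h * ξ))) -
        freq (h * ξ) ^ (α : ℂ) * ∑ l ∈ Finset.range n, (γ l : ℂ) * freq (h * ξ) ^ l) *
        𝓕 (toC u) ξ) := by
    have e1 : ((leftB α h u x : ℝ) : ℂ) = ∫ ξ, ((1 / h ^ α : ℝ) : ℂ) * (cexp (freq ξ * x) *
        (cexp (freq (h * ξ)) * genWC α (cexp (-freq (h * ξ))) * 𝓕 (toC u) ξ)) := by
      rw [leftB, ofReal_mul, tsum_leftBTerm_eq_integral h1 h2 hu hD (by omega),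
        integral_const_mul]
    have e2 : ((∑ l ∈ Finset.range n, γ l * rlDeriv (α + l) u x * h ^ l : ℝ) : ℂ) =
        ∫ ξ, ∑ l ∈ Finset.range n, (γ l : ℂ) *
          (cexp (freq ξ * x) * (freq ξ ^ ((α + l : ℝ) : ℂ) * 𝓕 (toC u) ξ)) * (h : ℂ) ^ l := by
      rw [integral_finsetSum _ hli, ofReal_sum]
      refine Finset.sum_congr rfl fun l hl' => ?_
      rw [integral_mul_const, integral_const_mul, ← hl l hl']
      push_cast
      ring
    rw [ofReal_sub, e1, e2, ← integral_sub ((hexp hSi).const_mul _) (integrable_finsetSum _ hli)]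
    refine integral_congr_ae (Eventually.of_forall fun ξ => ?_)
    simp only
    -- Homogeneity of the power under the positive scaling h, which matches the prefactor to the
    -- leading term.
    have hhα : ((1 / h ^ α : ℝ) : ℂ) * freq (h * ξ) ^ (α : ℂ) = freq ξ ^ (α : ℂ) := by
      rw [freq_mul, mul_comm (h : ℂ), mul_cpow_of_re (freq_re ξ).ge (by simpa using hh),
        ← ofReal_cpow hh.le, mul_left_comm, ← ofReal_mul,
        one_div_mul_cancel (Real.rpow_pos_of_pos hh α).ne', ofReal_one, mul_one]
    have hsum : ∑ l ∈ Finset.range n, (γ l : ℂ) *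
          (cexp (freq ξ * x) * (freq ξ ^ ((α + l : ℝ) : ℂ) * 𝓕 (toC u) ξ)) * (h : ℂ) ^ l =
        cexp (freq ξ * x) * (freq ξ ^ (α : ℂ) *
          (∑ l ∈ Finset.range n, (γ l : ℂ) * freq (h * ξ) ^ l) * 𝓕 (toC u) ξ) := by
      rw [Finset.mul_sum, Finset.sum_mul, Finset.mul_sum]
      refine Finset.sum_congr rfl fun l _ => ?_
      rw [cpow_add_natCast hα0, freq_mul, mul_pow]
      ring
    rw [hsum, ← hhα]
    ring
  rw [← Real.norm_eq_abs, ← norm_real, hkey]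
  refine (norm_integral_exp_freq_le _ x).trans ?_
  rw [mul_right_comm, ← integral_const_mul]
  refine integral_mono_of_nonneg (Eventually.of_forall fun _ => norm_nonneg _)
    (hdom.const_mul _) (Eventually.of_forall fun ξ => ?_)
  simp only
  have hb := hC (freq (h * ξ)) (freq_re _)
  have hn : ‖freq (h * ξ)‖ ^ (α + n) = h ^ α * h ^ n * ‖freq ξ‖ ^ (α + n) := by
    rw [freq_mul, norm_mul, norm_real, Real.norm_of_nonneg hh.le,
      Real.mul_rpow hh.le (norm_nonneg _), Real.rpow_add hh, Real.rpow_natCast]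
  have hpos : 0 < h ^ α := Real.rpow_pos_of_pos hh α
  rw [norm_mul, norm_mul, norm_real, Real.norm_of_nonneg (by positivity)]
  calc 1 / h ^ α * ‖cexp (freq (h * ξ)) * genWC α (cexp (-freq (h * ξ))) -
          freq (h * ξ) ^ (α : ℂ) * ∑ l ∈ Finset.range n, (γ l : ℂ) * freq (h * ξ) ^ l‖ *
        ‖𝓕 (toC u) ξ‖
      ≤ 1 / h ^ α * (C * ‖freq (h * ξ)‖ ^ (α + n)) * ‖𝓕 (toC u) ξ‖ := by gcongr
    _ = C * h ^ n * (‖freq ξ‖ ^ (α + n) * ‖𝓕 (toC u) ξ‖) := by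
        rw [hn]
        field_simp

end

end FracDiff

end

theorem theorem2 (α : ℝ) (hα1 : 1 < α) (hα2 : α ≤ 2) :
    ∃ γ : ℕ → ℝ,
      IsSymbolExpansion α γ ∧
      γ 0 = 1 ∧
      γ 1 = 0 ∧
      γ 2 = -((2 * α ^ 2 - 6 * α + 3) / (6 * α)) ∧
      γ 3 = (3 * α ^ 3 - 11 * α ^ 2 + 12 * α - 4) / (12 * α ^ 2) ∧
      ∀ n : ℕ, 2 ≤ n → ∀ u : ℝ → ℝ,
        ContDiff ℝ ((⌊α⌋₊ + n + 1 : ℕ) : WithTop ℕ∞) u →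
        DerivsInL1 (⌊α⌋₊ + n + 1) u →
        (∀ h : ℝ, 0 < h → ∀ x : ℝ, Summable (leftBTerm α h u x)) ∧
        (∀ l : ℕ, l < n → RLDifferentiable (α + l) u) ∧
        ∃ C : ℝ, ∀ h : ℝ, 0 < h → ∀ x : ℝ,
          |leftB α h u x -
            (rlDeriv α u x +
              ∑ l ∈ Finset.Ico 1 n, γ l * rlDeriv (α + l) u x * h ^ l)| ≤ C * h ^ n := by
  obtain ⟨γ, hγ⟩ := FracDiff.exists_symbol_coeff hα1 hα2
  obtain ⟨h0, hγ1, hγ2, hγ3⟩ := FracDiff.symbol_coeff_values hα1 hγ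
  refine ⟨γ, FracDiff.isSymbolExpansion hα1 hα2 hγ, h0, hγ1, hγ2, hγ3, fun n hn u hu hD => ?_⟩
  have hα0 : 0 ≤ α := by linarith
  have hb := FracDiff.bddL1_iteratedDeriv hu hD (k := 0) (by omega)
  rw [iteratedDeriv_zero] at hb
  refine ⟨fun h _ x => FracDiff.summable_leftBTerm hα1 hα2 hb h x, fun l hl => ?_, ?_⟩
  · exact FracDiff.rlDifferentiable hu hD (by positivity)
      (by rw [FracDiff.rlOrder_add_natCast hα0]; omega)
  · obtain ⟨C, hC⟩ := FracDiff.exists_leftB_expansion_bound hα1 hα2 hγ hu hD rfl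
    refine ⟨C, fun h hh x => ?_⟩
    have := hC h hh x
    rwa [Finset.range_eq_Ico, Finset.sum_eq_sum_Ico_succ_bot (by omega : 0 < n), h0, Nat.cast_zero,
      add_zero, pow_zero, mul_one, one_mul] at this
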